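/- Work in the first-order language $\{0,1,+,\cdot,\le\}$. The theory $I\Delta_0$ consists of the axioms $PA^-$ of the non-negative parts of discretely ordered rings together with induction for all bounded ($\Delta_0$) formulas (with parameters), and $\Omega_1$ is the axiom stating that $x^{\lfloor\log_2 y\rfloor}$ exists for all $x$ and all $y>0$. Here $\lfloor\log_c m\rfloor$ denotes the unique $l$ with $c^l\le m<c^{l+1}$, and $x^y=z$ is expressed by an arithmetical formula saying that there is a coded sequence of length $y+1$ starting with $1$, each further term being $x$ times the preceding one, and ending with $z$. Theorem (Legendre normal form). Let $\mathcal M$ be a model of $I\Delta_0+\Omega_1$, and let $a,b\in\mathcal M$ be positive and square-free (the only $y\in\mathcal M$ with $y^2\mid a$ is $y=1$, and likewise for $b$). Then the equation $$ax^2+by^2=z^2$$ has a solution $(x,y,z)\ne(0,0,0)$ in $\mathcal M$ if and only if the following three conditions hold: 1. $a$ is a square modulo $b$; 2. $b$ is a square modulo $a$; 3. $-\frac{ab}{d^2}$ is a square modulo $d$, where $d=\gcd(a,b)$. Moreover, if these conditions hold, then there is a solution $(x,y,z)\neq(0,0,0)$ in $\mathcal M$ with $$x,\,y,\,z\ \le\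 b\left(\tfrac32a\right)^{\lfloor\log_4a\rfloor}\left(\tfrac32b\right)^{\lfloor\log_4b\rfloor},$$ where $2^{k},(3a)^{k},2^{l},(3b)^{l}$ with $k=\lfloor\log_4a\rfloor$, $l=\lfloor\log_4b\rfloor$ exist in $\mathcal M$, and the bound means $2^{k}2^{l}\,t\le b\,(3a)^{k}(3b)^{l}$ for each $t\in\{x,y,z\}$. -/

import Mathlib

open FirstOrder

namespace WeakArith

/-! ### The language of arithmetic `{0, 1, +, ·, ≤}` and its structures -/

/-- Function symbols `0, 1, +, ·`. -/
inductive ArithFunc : ℕ → Type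
  | zero : ArithFunc 0
  | one : ArithFunc 0
  | add : ArithFunc 2
  | mul : ArithFunc 2

/-- The only relation symbol is `≤`. -/
inductive ArithRel : ℕ → Type
  | le : ArithRel 2

/-- The first-order language `{0, 1, +, ·, ≤}`. -/
def arith : Language where
  Functions := ArithFunc
  Relations := ArithRel

instance : Language.IsOrdered arith where
  leSymb := ArithRel.le

/-- A type with distinguished `0, 1, +, ·, ≤` (no laws) is a structure for the language. -/
instance arithStructure (M : Type*) [Zero M] [One M] [Add M] [Mul M] [LE M] :
    arith.Structure M where
  funMap {_} f := match f with
    | ArithFunc.zero => fun _ => 0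
    | ArithFunc.one => fun _ => 1
    | ArithFunc.add => fun v => v 0 + v 1
    | ArithFunc.mul => fun v => v 0 * v 1
  RelMap {_} r := match r with
    | ArithRel.le => fun v => v 0 ≤ v 1

open Language in
/-- `IsDelta0 φ`: the formula `φ` is bounded, i.e. it is built from atomic formulas with
propositional connectives and the bounded quantifiers `∀ x ≤ t` and `∃ x ≤ t`, where `t` is a term
in which the quantified variable `x` does not occur.  (In a formula with the `n` bound variables
`0, …, n - 1` in scope, the next quantified variable is number `n`.) -/
inductive IsDelta0 {α : Type*} : ∀ {n : ℕ}, arith.BoundedFormula α n → Prop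
  | falsum {n : ℕ} : IsDelta0 (BoundedFormula.falsum (L := arith) (α := α) (n := n))
  | equal {n : ℕ} (t u : arith.Term (α ⊕ Fin n)) : IsDelta0 (BoundedFormula.equal t u)
  | le {n : ℕ} (t u : arith.Term (α ⊕ Fin n)) : IsDelta0 (t.le u)
  | imp {n : ℕ} {φ ψ : arith.BoundedFormula α n} (hφ : IsDelta0 φ) (hψ : IsDelta0 ψ) :
      IsDelta0 (φ.imp ψ)
  | ball {n : ℕ} (t : arith.Term (α ⊕ Fin n)) {φ : arith.BoundedFormula α (n + 1)}
      (hφ : IsDelta0 φ) :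
      IsDelta0 (BoundedFormula.all
        (((Term.var (Sum.inr (Fin.last n))).le
          (t.relabel (Sum.map id Fin.castSucc))).imp φ))
  | bex {n : ℕ} (t : arith.Term (α ⊕ Fin n)) {φ : arith.BoundedFormula α (n + 1)}
      (hφ : IsDelta0 φ) :
      IsDelta0 (BoundedFormula.ex
        ((Term.var (Sum.inr (Fin.last n))).le
          (t.relabel (Sum.map id Fin.castSucc)) ⊓ φ))

section Structures

variable {M : Type*} [Zero M] [One M] [Add M] [Mul M] [LE M]

/-- Strict order. -/
def Lt (x y : M) : Prop := x ≤ y ∧ x ≠ y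

variable (M) in
/-- The basic axioms `PA⁻`: `M` is the non-negative part of a discretely ordered ring. -/
structure PAMinus : Prop where
  add_assoc : ∀ x y z : M, (x + y) + z = x + (y + z)
  add_comm : ∀ x y : M, x + y = y + x
  mul_assoc : ∀ x y z : M, (x * y) * z = x * (y * z)
  mul_comm : ∀ x y : M, x * y = y * x
  mul_add : ∀ x y z : M, x * (y + z) = x * y + x * z
  add_zero : ∀ x : M, x + 0 = x
  mul_zero : ∀ x : M, x * 0 = 0
  mul_one : ∀ x : M, x * 1 = x
  le_refl : ∀ x : M, x ≤ x
  le_trans : ∀ x y z : M, x ≤ y → y ≤ z → x ≤ z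
  le_antisymm : ∀ x y : M, x ≤ y → y ≤ x → x = y
  le_total : ∀ x y : M, x ≤ y ∨ y ≤ x
  add_lt_add : ∀ x y z : M, Lt x y → Lt (x + z) (y + z)
  mul_lt_mul : ∀ x y z : M, Lt 0 z → Lt x y → Lt (x * z) (y * z)
  exists_add : ∀ x y : M, x ≤ y → ∃ z : M, x + z = y
  zero_le : ∀ x : M, 0 ≤ x
  zero_lt_one : Lt (0 : M) 1
  one_le : ∀ x : M, Lt 0 x → 1 ≤ x

variable (M) in
/-- The induction schema for bounded formulas, with parameters `p`. -/
def Delta0Induction : Prop :=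
  ∀ (φ : arith.BoundedFormula ℕ 1), IsDelta0 φ → ∀ p : ℕ → M,
    φ.Realize p ![0] → (∀ x : M, φ.Realize p ![x] → φ.Realize p ![x + 1]) →
      ∀ x : M, φ.Realize p ![x]

/-- `IsBeta w d i u`: Gödel's `β` function takes the value `u` at `(w, d, i)`, that is, `u` is the
remainder of `w` on division by `1 + (i + 1) * d`. -/
def IsBeta (w d i u : M) : Prop :=
  Lt u (1 + (i + 1) * d) ∧ ∃ q : M, w = q * (1 + (i + 1) * d) + u

/-- The graph of exponentiation, `x ^ y = z`: some pair `(w, d)` codes, by Gödel's `β` function, a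
sequence of length `y + 1` which starts with `1`, in which every entry is `x` times the preceding
one, and whose last entry is `z`.  Two such sequences agree by bounded induction, and a coded
sequence also satisfies the recursion of any bounded formula that defines exponentiation.  In a
model of `IΔ₀ + Ω₁` every sequence of powers whose length is at most a logarithm has a code, so for
the (logarithmic) exponents occurring below this is the usual graph, and `Ω₁` stated with it is
equivalent over `IΔ₀` to `Ω₁` stated with a bounded definition of exponentiation. -/
def IsPow (x y z : M) : Prop :=
  ∃ w d : M, IsBeta w d 0 1 ∧
    (∀ i : M, Lt i y → ∃ u : M, IsBeta w d i u ∧ IsBeta w d (i + 1) (x * u)) ∧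
    IsBeta w d y z

/-- `l` is the integer part of the logarithm of `m` to base `c`: `c ^ l ≤ m < c ^ (l + 1)`. -/
def IsLog (c m l : M) : Prop :=
  ∃ q : M, IsPow c l q ∧ q ≤ m ∧ Lt m (c * q)

variable (M) in
/-- The axiom `Ω₁`: `x ^ (log₂ y)` exists for all `x` and all `y > 0`. -/
def Omega1 : Prop :=
  ∀ x y : M, Lt 0 y → ∃ l z : M, IsLog (1 + 1) y l ∧ IsPow x l z

variable (M) in
/-- `M` is a model of the theory `IΔ₀ + Ω₁`. -/
structure ModelIDelta0Omega1 : Prop where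
  paMinus : PAMinus M
  induction : Delta0Induction M
  omega1 : Omega1 M

/-! ### Number-theoretic notions in `M`

The elements of `M` are the non-negative "integers", so congruences are written without
subtraction. -/

/-- Divisibility in `M`. -/
def Divides (x y : M) : Prop := ∃ z : M, y = x * z

/-- No square other than `1` divides `a`. -/
def SquareFree (a : M) : Prop := ∀ y : M, Divides (y * y) a → y = 1

/-- `d` is the greatest common divisor of `a` and `b`. -/
def IsGCD (d a b : M) : Prop :=
  Divides d a ∧ Divides d b ∧ ∀ t : M, Divides t a → Divides t b → Divides t d

/-- `a ≡ c` modulo `b`. -/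
def Cong (a c b : M) : Prop := ∃ m : M, a = c + m * b ∨ c = a + m * b

/-- `a` is a square modulo `b`. -/
def SquareMod (a b : M) : Prop := ∃ x : M, Cong (x * x) a b

/-- `-e` is a square modulo `d`, i.e. `x² + e ≡ 0` modulo `d` for some `x`. -/
def NegSquareMod (e d : M) : Prop := ∃ x : M, Cong (x * x + e) 0 d

/-- `(x, y, z)` is a non-trivial solution of `a x² + b y² = z²`. -/
def IsSolution (a b x y z : M) : Prop :=
  ¬ (x = 0 ∧ y = 0 ∧ z = 0) ∧ a * (x * x) + b * (y * y) = z * z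

/-- The three conditions: `a` is a square modulo `b`, `b` is a square modulo `a`, and
`-(a b / d²)` is a square modulo `d`, where `d` is the greatest common divisor of `a` and `b`. -/
def NormConditions (a b : M) : Prop :=
  SquareMod a b ∧ SquareMod b a ∧
    ∃ d e : M, IsGCD d a b ∧ e * (d * d) = a * b ∧ NegSquareMod e d

/-- Each of `x, y, z` is at most `b (3a/2)^k (3b/2)^l`, where `k = ⌊log₄ a⌋` and `l = ⌊log₄ b⌋`.
The denominators `2 ^ k` and `2 ^ l` are cleared, and the powers involved are asserted to exist
in `M`: here `A = (3a)^k`, `A' = 2^k`, `B = (3b)^l`, `B' = 2^l`. -/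
def LegendreBound (a b x y z : M) : Prop :=
  ∃ k l A A' B B' : M,
    IsLog (1 + 1 + 1 + 1) a k ∧ IsLog (1 + 1 + 1 + 1) b l ∧
    IsPow ((1 + 1 + 1) * a) k A ∧ IsPow (1 + 1) k A' ∧
    IsPow ((1 + 1 + 1) * b) l B ∧ IsPow (1 + 1) l B' ∧
    x * (A' * B') ≤ b * (A * B) ∧
    y * (A' * B') ≤ b * (A * B) ∧
    z * (A' * B') ≤ b * (A * B)

end Structures

end WeakArith

/-!
The theorem is proved by Legendre's descent, organised so that the induction is on a bounded formula.

Necessity of the three conditions is pure divisibility theory (`legendre_conditions_of_solution`):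
in a primitive solution `x` is invertible modulo `b`, and `y` modulo `a`, because `a` and `b` are
square-free, so the equation can be solved for `a` modulo `b` and for `b` modulo `a`. No primes or
factorisations are used, only that greatest common divisors are linear combinations. The argument
therefore takes place in the ring `Integers M` of formal differences of elements of `M`, which is an
ordered Bézout domain by Bézout's identity in `M` (`exists_bezout`, by induction along the
subtractive Euclidean algorithm).

For sufficiency let `1 < b < a`. A square root `c ≤ a / 2` of `b` modulo `a` gives
`c² = b + a A m²` with `A` square-free and `A < a / 4` (`exists_descent`). The conditions pass from
`a, b` to `A, b` (`NormConditions.descent`), and a solution `X, Y, Z` for `A, b` yields the solution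
`A m X, c Y + Z, b Y + c Z` for `a, b`, which is larger by a factor of at most `3 a / 2`
(`HasSolution.ascent`). The case `a < b` is symmetric. The descent ends with `a = 1`, `b = 1` or
`a = b`; in the last case `-1` is a square modulo `a`, so `a` is a sum of two squares `s² + t²`
(`exists_sum_two_squares`) and `(s, t, a)` is a solution. In all three cases the entries are at most
`b`. Each step divides a coefficient by more than `4`, so there are at most `⌊log₄ a⌋` steps of the
first kind and `⌊log₄ b⌋` of the second, which gives the bound.

To carry this out in `M`, the claim for all smaller coefficients must be a bounded formula
(`hasSolution_of_normConditions`). The bound on the solutions involves powers with variable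
exponents; the bases `2`, `3 a`, `3 b` of the powers are kept fixed, at the initial `a, b`, and `Ω₁`
supplies codes for the three sequences of powers up to a common logarithmic length
(`Omega1.exists_powSeq`). With these codes as parameters the powers are values of the `β` function,
whose graph is bounded. Definability is handled semantically, through closure properties of
the predicates `Delta0Def`.
-/

namespace WeakArith

/-! ### Predicates definable by bounded formulas -/

section Definability

variable {M : Type*} [Zero M] [One M] [Add M] [Mul M] [LE M] {n : ℕ}

open Language

/-- `f` is given by a term with parameters from `M`.  Finitely many parameters (the list `l`)
suffice, and the term exists for every assignment `p` of the free variables whose range contains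
them; with this formulation definitions with different parameters are combined by appending the
lists, without renaming variables. -/
def TermDef (f : (Fin n → M) → M) : Prop :=
  ∃ l : List M, ∀ p : ℕ → M, (∀ a ∈ l, ∃ i, p i = a) →
    ∃ t : arith.Term (ℕ ⊕ Fin n), ∀ v, t.realize (Sum.elim p v) = f v

/-- `S` is defined by a bounded formula with parameters from `M`, with the parameters treated as in
`TermDef`. -/
def Delta0Def (S : (Fin n → M) → Prop) : Prop :=
  ∃ l : List M, ∀ p : ℕ → M, (∀ a ∈ l, ∃ i, p i = a) →
    ∃ φ : arith.BoundedFormula ℕ n, IsDelta0 φ ∧ ∀ v, φ.Realize p v ↔ S v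

theorem TermDef.var (i : Fin n) : TermDef (fun v : Fin n → M => v i) :=
  ⟨[], fun _ _ => ⟨Term.var (Sum.inr i), fun _ => rfl⟩⟩

theorem TermDef.const (a : M) : TermDef (fun _ : Fin n → M => a) := by
  refine ⟨[a], fun p hp => ?_⟩
  obtain ⟨i, hi⟩ := hp a (by simp)
  exact ⟨Term.var (Sum.inl i), fun _ => hi⟩

theorem TermDef.add {f g : (Fin n → M) → M} (hf : TermDef f) (hg : TermDef g) :
    TermDef (fun v => f v + g v) := by
  obtain ⟨l, hl⟩ := hf
  obtain ⟨k, hk⟩ := hg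
  refine ⟨l ++ k, fun p hp => ?_⟩
  obtain ⟨t, ht⟩ := hl p fun a ha => hp a (by simp [ha])
  obtain ⟨u, hu⟩ := hk p fun a ha => hp a (by simp [ha])
  refine ⟨Term.func (L := arith) (l := 2) ArithFunc.add ![t, u], fun v => ?_⟩
  exact congrArg₂ (· + ·) (ht v) (hu v)

theorem TermDef.mul {f g : (Fin n → M) → M} (hf : TermDef f) (hg : TermDef g) :
    TermDef (fun v => f v * g v) := by
  obtain ⟨l, hl⟩ := hf
  obtain ⟨k, hk⟩ := hg
  refine ⟨l ++ k, fun p hp => ?_⟩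
  obtain ⟨t, ht⟩ := hl p fun a ha => hp a (by simp [ha])
  obtain ⟨u, hu⟩ := hk p fun a ha => hp a (by simp [ha])
  refine ⟨Term.func (L := arith) (l := 2) ArithFunc.mul ![t, u], fun v => ?_⟩
  exact congrArg₂ (· * ·) (ht v) (hu v)

/-- Weakening a term by one bound variable does not change its value. -/
theorem realize_lift {α : Type*} (t : arith.Term (α ⊕ Fin n)) (p : α → M) (v : Fin n → M) (x : M) :
    (t.relabel (Sum.map id Fin.castSucc)).realize (Sum.elim p (Fin.snoc v x)) =
      t.realize (Sum.elim p v) := by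
  rw [Term.realize_relabel]
  congr 1
  funext s
  cases s <;> simp

theorem TermDef.lift {f : (Fin n → M) → M} (hf : TermDef f) :
    TermDef (fun w : Fin (n + 1) → M => f fun i => w i.castSucc) := by
  obtain ⟨l, hl⟩ := hf
  refine ⟨l, fun p hp => ?_⟩
  obtain ⟨t, ht⟩ := hl p hp
  refine ⟨t.relabel (Sum.map id Fin.castSucc), fun w => ?_⟩
  refine Eq.trans ?_ (ht fun i => w i.castSucc)
  rw [← realize_lift t p _ (w (Fin.last n))]
  congr 2
  exact (Fin.snoc_init_self w).symm

theorem Delta0Def.congr {S T : (Fin n → M) → Prop} (hS : Delta0Def S) (h : ∀ v, T v ↔ S v) :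
    Delta0Def T := by
  obtain rfl : T = S := funext fun v => propext (h v)
  exact hS

theorem Delta0Def.eq {f g : (Fin n → M) → M} (hf : TermDef f) (hg : TermDef g) :
    Delta0Def (fun v => f v = g v) := by
  obtain ⟨l, hl⟩ := hf
  obtain ⟨k, hk⟩ := hg
  refine ⟨l ++ k, fun p hp => ?_⟩
  obtain ⟨t, ht⟩ := hl p fun a ha => hp a (by simp [ha])
  obtain ⟨u, hu⟩ := hk p fun a ha => hp a (by simp [ha])
  refine ⟨_, IsDelta0.equal t u, fun v => ?_⟩
  exact Eq.congr (ht v) (hu v)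

theorem Delta0Def.le {f g : (Fin n → M) → M} (hf : TermDef f) (hg : TermDef g) :
    Delta0Def (fun v => f v ≤ g v) := by
  obtain ⟨l, hl⟩ := hf
  obtain ⟨k, hk⟩ := hg
  refine ⟨l ++ k, fun p hp => ?_⟩
  obtain ⟨t, ht⟩ := hl p fun a ha => hp a (by simp [ha])
  obtain ⟨u, hu⟩ := hk p fun a ha => hp a (by simp [ha])
  refine ⟨_, IsDelta0.le t u, fun v => ?_⟩
  exact Iff.of_eq (congrArg₂ (· ≤ ·) (ht v) (hu v))

theorem Delta0Def.imp {S T : (Fin n → M) → Prop} (hS : Delta0Def S) (hT : Delta0Def T) :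
    Delta0Def (fun v => S v → T v) := by
  obtain ⟨l, hl⟩ := hS
  obtain ⟨k, hk⟩ := hT
  refine ⟨l ++ k, fun p hp => ?_⟩
  obtain ⟨t, ht', ht⟩ := hl p fun a ha => hp a (by simp [ha])
  obtain ⟨u, hu', hu⟩ := hk p fun a ha => hp a (by simp [ha])
  refine ⟨_, ht'.imp hu', fun v => ?_⟩
  exact imp_congr (ht v) (hu v)

theorem Delta0Def.false : Delta0Def (fun _ : Fin n → M => False) :=
  ⟨[], fun _ _ => ⟨_, .falsum, fun _ => Iff.rfl⟩⟩

theorem Delta0Def.not {S : (Fin n → M) → Prop} (hS : Delta0Def S) :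
    Delta0Def (fun v => ¬ S v) :=
  hS.imp .false

theorem Delta0Def.and {S T : (Fin n → M) → Prop} (hS : Delta0Def S) (hT : Delta0Def T) :
    Delta0Def (fun v => S v ∧ T v) :=
  (hS.imp hT.not).not.congr fun v => by tauto

theorem Delta0Def.or {S T : (Fin n → M) → Prop} (hS : Delta0Def S) (hT : Delta0Def T) :
    Delta0Def (fun v => S v ∨ T v) :=
  (hS.not.imp hT).congr fun v => by tauto

theorem Delta0Def.ball {f : (Fin n → M) → M} {S : (Fin n → M) → M → Prop} (hf : TermDef f)
    (hS : Delta0Def fun w : Fin (n + 1) → M => S (fun i => w i.castSucc) (w (Fin.last n))) :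
    Delta0Def (fun v => ∀ x, x ≤ f v → S v x) := by
  obtain ⟨l, hl⟩ := hf
  obtain ⟨k, hk⟩ := hS
  refine ⟨l ++ k, fun p hp => ?_⟩
  obtain ⟨t, ht⟩ := hl p fun a ha => hp a (by simp [ha])
  obtain ⟨φ, hφ', hφ⟩ := hk p fun a ha => hp a (by simp [ha])
  refine ⟨_, hφ'.ball t, fun v => ?_⟩
  refine forall_congr' fun x => imp_congr (Iff.of_eq (congrArg₂ (· ≤ ·) ?_ ?_)) ?_
  · exact Fin.snoc_last (α := fun _ => M) x v
  · exact (realize_lift t p v x).trans (ht v)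
  · refine (hφ _).trans ?_
    simp

theorem Delta0Def.bex {f : (Fin n → M) → M} {S : (Fin n → M) → M → Prop} (hf : TermDef f)
    (hS : Delta0Def fun w : Fin (n + 1) → M => S (fun i => w i.castSucc) (w (Fin.last n))) :
    Delta0Def (fun v => ∃ x, x ≤ f v ∧ S v x) :=
  ((hS.not.ball (S := fun v x => ¬ S v x) hf).not).congr fun v => by simp

/-- Induction for predicates that are definable by a bounded formula with parameters. -/
theorem Delta0Induction.induct (h : Delta0Induction M) {S : M → Prop}
    (hS : Delta0Def fun v : Fin 1 → M => S (v 0)) (zero : S 0) (succ : ∀ x, S x → S (x + 1))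
    (x : M) : S x := by
  obtain ⟨l, hl⟩ := hS
  obtain ⟨φ, hφ', hφ⟩ := hl (fun i => l.getD i 0) fun a ha => by
    obtain ⟨i, hi, rfl⟩ := List.getElem_of_mem ha
    exact ⟨i, by simp [hi]⟩
  have key := h φ hφ' (fun i => l.getD i 0)
  simp only [hφ] at key
  exact key zero succ x

end Definability

/-! ### Bounded arithmetic in terms of ordered semirings -/

/-- A model of `IΔ₀`, bundled with Mathlib's algebraic and order structure. -/
class BoundedArith (M : Type*) [CommSemiring M] [LinearOrder M] : Prop
    extends IsStrictOrderedRing M, CanonicallyOrderedAdd M where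
  one_le_of_pos : ∀ x : M, 0 < x → 1 ≤ x
  induction : Delta0Induction M

section Bundling

variable {M : Type*} [Zero M] [One M] [Add M] [Mul M] [LE M]

/-- The commutative semiring structure of a model of `PA⁻`. -/
abbrev PAMinus.commSemiring (h : PAMinus M) : CommSemiring M where
  add_assoc := h.add_assoc
  add_comm := h.add_comm
  zero_add x := by rw [h.add_comm, h.add_zero]
  add_zero := h.add_zero
  mul_assoc := h.mul_assoc
  mul_comm := h.mul_comm
  one_mul x := by rw [h.mul_comm, h.mul_one]
  mul_one := h.mul_one
  zero_mul x := by rw [h.mul_comm, h.mul_zero]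
  mul_zero := h.mul_zero
  left_distrib := h.mul_add
  right_distrib x y z := by rw [h.mul_comm, h.mul_add, h.mul_comm z, h.mul_comm z]
  nsmul := nsmulRec

open Classical in
/-- The linear order of a model of `PA⁻`. -/
noncomputable abbrev PAMinus.linearOrder (h : PAMinus M) : LinearOrder M where
  le_refl := h.le_refl
  le_trans := h.le_trans
  le_antisymm := h.le_antisymm
  le_total := h.le_total
  toDecidableLE := Classical.decRel _

theorem PAMinus.boundedArith (h : PAMinus M) (hi : Delta0Induction M) :
    @BoundedArith M h.commSemiring h.linearOrder := by
  let := h.commSemiring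
  let := h.linearOrder
  have lt_iff : ∀ x y : M, Lt x y ↔ x < y := fun x y => lt_iff_le_and_ne.symm
  have add_le : ∀ x y z : M, x ≤ y → x + z ≤ y + z := by
    intro x y z hxy
    rcases hxy.eq_or_lt with rfl | hxy
    · exact le_rfl
    · exact (h.add_lt_add x y z ((lt_iff _ _).2 hxy)).1
  exact
    { add_le_add_left := fun x y hxy z => add_le x y z hxy
      le_of_add_le_add_left := fun x y z hxy => by
        by_contra! hzy
        have := (lt_iff _ _).1 (h.add_lt_add z y x ((lt_iff _ _).2 hzy))
        rw [h.add_comm z, h.add_comm y] at this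
        exact this.not_ge hxy
      zero_le_one := h.zero_le 1
      exists_pair_ne := ⟨0, 1, h.zero_lt_one.2⟩
      mul_lt_mul_of_pos_left := fun z hz x y hxy => by
        rw [h.mul_comm z, h.mul_comm z]
        exact (lt_iff _ _).1 (h.mul_lt_mul x y z ((lt_iff _ _).2 hz) ((lt_iff _ _).2 hxy))
      mul_lt_mul_of_pos_right := fun z hz x y hxy =>
        (lt_iff _ _).1 (h.mul_lt_mul x y z ((lt_iff _ _).2 hz) ((lt_iff _ _).2 hxy))
      exists_add_of_le := fun {x y} hxy => (h.exists_add x y hxy).imp fun _ hz => hz.symm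
      le_add_self := fun x y => by
        have := add_le 0 y x (h.zero_le y)
        rwa [h.add_comm, h.add_zero] at this
      le_self_add := fun x y => by
        have := add_le 0 y x (h.zero_le y)
        rwa [h.add_comm, h.add_zero, h.add_comm] at this
      one_le_of_pos := fun x hx => h.one_le x ((lt_iff _ _).2 hx)
      induction := hi }

end Bundling

theorem lt_iff {M : Type*} [PartialOrder M] {x y : M} : Lt x y ↔ x < y := lt_iff_le_and_ne.symm

theorem divides_iff {M : Type*} [CommSemiring M] {x y : M} : Divides x y ↔ x ∣ y := Iff.rfl

theorem Delta0Def.lt {M : Type*} [Zero M] [One M] [Add M] [Mul M] [LinearOrder M] {n : ℕ}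
    {f g : (Fin n → M) → M} (hf : TermDef f) (hg : TermDef g) :
    Delta0Def (fun v => f v < g v) :=
  (Delta0Def.le hg hf).not.congr fun _ => not_le.symm

section BoundedArith

variable {M : Type*} [CommSemiring M] [LinearOrder M] [BoundedArith M]

theorem add_one_le_iff {x y : M} : x + 1 ≤ y ↔ x < y := by
  refine ⟨fun h => (lt_add_one x).trans_le h, fun h => ?_⟩
  obtain ⟨z, rfl⟩ := exists_add_of_le h.le
  gcongr
  exact BoundedArith.one_le_of_pos z (pos_of_lt_add_right h)

theorem lt_add_one_iff {x y : M} : x < y + 1 ↔ x ≤ y := by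
  rw [← not_le, add_one_le_iff, not_lt]

theorem le_mul_of_pos {x y : M} (hy : 0 < y) : x ≤ x * y :=
  le_mul_of_one_le_right zero_le (BoundedArith.one_le_of_pos y hy)

theorem le_of_dvd {x y : M} (hy : 0 < y) (h : x ∣ y) : x ≤ y := by
  obtain ⟨z, rfl⟩ := h
  exact le_mul_of_pos (pos_of_mul_pos_right hy zero_le)

theorem Delta0Def.dvd {n : ℕ} {f g : (Fin n → M) → M} (hf : TermDef f) (hg : TermDef g) :
    Delta0Def (fun v => f v ∣ g v) := by
  refine (Delta0Def.bex (S := fun v z => g v = f v * z) hg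
    (.eq hg.lift (hf.lift.mul (.var _)))).congr fun v => ⟨?_, fun ⟨z, _, hz⟩ => ⟨z, hz⟩⟩
  rintro ⟨z, hz⟩
  rcases eq_zero_or_pos (f v) with h0 | h0
  · exact ⟨0, zero_le, by rw [hz, h0, zero_mul, zero_mul]⟩
  · exact ⟨z, by rw [hz, mul_comm]; exact le_mul_of_pos h0, hz⟩

theorem strong_induct {S : M → Prop} (hS : Delta0Def fun v : Fin 2 → M => S (v 1))
    (ind : ∀ x, (∀ y < x, S y) → S x) (x : M) : S x := by
  have key : ∀ x : M, ∀ y ≤ x, S y := by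
    refine Delta0Induction.induct BoundedArith.induction (.ball (.var _) hS) ?_ ?_
    · intro y hy
      exact ind y fun z hz => absurd (hz.trans_le hy) not_lt_zero
    · intro x hx y hy
      exact ind y fun z hz => hx z (lt_add_one_iff.1 (hz.trans_le hy))
  exact key x x le_rfl

theorem exists_least {S : M → Prop} (hS : Delta0Def fun v : Fin 2 → M => S (v 1)) {x : M}
    (hx : S x) : ∃ y, S y ∧ ∀ z, S z → y ≤ z := by
  by_contra! h
  refine strong_induct (S := fun y => ¬ S y) hS.not (fun y hy hSy => ?_) x hx
  obtain ⟨z, hz, hzy⟩ := h y hSy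
  exact hy z hzy hz

/-- Division with remainder. -/
theorem exists_div_mod (a : M) {b : M} (hb : 0 < b) : ∃ q r, a = b * q + r ∧ r < b := by
  suffices h : ∃ q ≤ a, ∃ r ≤ b, a = b * q + r ∧ r < b by
    obtain ⟨q, -, r, -, h⟩ := h
    exact ⟨q, r, h⟩
  refine Delta0Induction.induct (S := fun a => ∃ q ≤ a, ∃ r ≤ b, a = b * q + r ∧ r < b)
    BoundedArith.induction ?_ ?_ ?_ a
  · apply_rules [Delta0Def.bex, Delta0Def.and, Delta0Def.eq, Delta0Def.lt, TermDef.add,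
      TermDef.mul, TermDef.var, TermDef.const]
  · exact ⟨0, le_rfl, 0, zero_le, by simp, hb⟩
  · rintro a ⟨q, hq, r, hr, rfl, hrb⟩
    rcases (add_one_le_iff.2 hrb).eq_or_lt with h | h
    · refine ⟨q + 1, by gcongr, 0, zero_le, ?_, hb⟩
      rw [add_assoc, h]
      ring
    · exact ⟨q, hq.trans (le_add_of_nonneg_right zero_le), r + 1, h.le, add_assoc _ _ _, h⟩

/-- Bézout's identity, written without subtraction.  The coefficients are bounded, which makes the
statement accessible to induction along the subtractive Euclidean algorithm. -/
theorem exists_bezout {a b : M} (ha : 0 < a) (hb : 0 < b) :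
    ∃ g x y, g ∣ a ∧ g ∣ b ∧ (a * x = b * y + g ∨ b * y = a * x + g) := by
  have key : ∀ n : M, ∀ a ≤ n, ∀ b ≤ n, a + b ≤ n → 0 < a → 0 < b → ∃ g ≤ n, ∃ x ≤ b, ∃ y ≤ a,
      g ∣ a ∧ g ∣ b ∧ (a * x = b * y + g ∨ b * y = a * x + g) := by
    refine strong_induct ?_ ?_
    · apply_rules (maxDepth := 200) [Delta0Def.ball, Delta0Def.bex, Delta0Def.and, Delta0Def.or,
        Delta0Def.eq, Delta0Def.dvd, Delta0Def.lt, Delta0Def.le, Delta0Def.imp, TermDef.add, TermDef.mul,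
        TermDef.var, TermDef.const]
    · intro n ih a han b hbn hab ha hb
      rcases lt_trichotomy a b with h | rfl | h
      · obtain ⟨c, rfl⟩ := exists_add_of_le h.le
        have hc : 0 < c := pos_of_lt_add_right h
        obtain ⟨g, hg, x, hx, y, hy, hga, hgc, hgxy⟩ := ih (a + c)
          ((lt_add_of_pos_left _ ha).trans_le hab) a (le_add_of_nonneg_right zero_le) c
          (le_add_of_nonneg_left zero_le) le_rfl ha hc
        refine ⟨g, (le_of_dvd ha hga).trans han, x + y, ?_, y, hy, hga, hga.add hgc, ?_⟩
        · rw [add_comm]; gcongr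
        · refine hgxy.imp (fun h => ?_) fun h => ?_
          · rw [mul_add, h]; ring
          · rw [add_mul, h]; ring
      · exact ⟨a, han, 1, BoundedArith.one_le_of_pos _ ha, 0, zero_le, dvd_rfl, dvd_rfl,
          .inl (by simp)⟩
      · obtain ⟨c, rfl⟩ := exists_add_of_le h.le
        have hc : 0 < c := pos_of_lt_add_right h
        obtain ⟨g, hg, x, hx, y, hy, hga, hgc, hgxy⟩ := ih (b + c)
          ((lt_add_of_pos_right _ hb).trans_le hab) c (le_add_of_nonneg_left zero_le) b
          (le_add_of_nonneg_right zero_le) (add_comm c b).le hc hb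
        refine ⟨g, (le_of_dvd hb hgc).trans hbn, x, hx, x + y, ?_, hgc.add hga, hgc, ?_⟩
        · gcongr
        · refine hgxy.imp (fun h => ?_) fun h => ?_
          · rw [add_mul, h]; ring
          · rw [mul_add, h]; ring
  obtain ⟨g, -, x, -, y, -, h⟩ := key (a + b) a (le_add_of_nonneg_right zero_le) b
    (le_add_of_nonneg_left zero_le) le_rfl ha hb
  exact ⟨g, x, y, h⟩

/-- A positive element is a square times a square-free element: take the least cofactor of a
square. -/
theorem exists_squareFree_mul_sq {n : M} (hn : 0 < n) :
    ∃ a m : M, n = a * (m * m) ∧ SquareFree a := by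
  obtain ⟨a, ⟨m, -, h⟩, hmin⟩ := exists_least (S := fun a : M => ∃ m ≤ n, n = a * (m * m))
    (by apply_rules [Delta0Def.bex, Delta0Def.eq, TermDef.mul, TermDef.var, TermDef.const])
    (x := n) ⟨1, BoundedArith.one_le_of_pos n hn, by simp⟩
  refine ⟨a, m, h, ?_⟩
  rintro y ⟨c, rfl⟩
  have hn' : n = c * ((y * m) * (y * m)) := by rw [h]; ring
  have hpos : 0 < c ∧ 0 < y * m := by
    constructor <;> refine pos_iff_ne_zero.2 fun h0 => hn.ne' ?_ <;> rw [hn', h0] <;> ring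
  have hy : 0 < y := pos_of_mul_pos_left hpos.2 zero_le
  have hle : y * y * c ≤ c := hmin c ⟨y * m, by
    rw [hn']
    calc y * m ≤ y * m * (y * m) := le_mul_of_pos hpos.2
      _ ≤ _ := by rw [mul_comm c]; exact le_mul_of_pos hpos.1, hn'⟩
  have hyy : y * y ≤ 1 := le_of_mul_le_mul_right (by simpa using hle) hpos.1
  exact le_antisymm ((le_mul_of_pos hy).trans hyy) (BoundedArith.one_le_of_pos y hy)

/-- If `a m = r² + 1`, then the binary quadratic form `a X² + 2 r X Y + m Y²` of determinant `1` is
equivalent to `X² + Y²`; in particular `a` is a sum of two squares.  The proof is the reduction of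
such forms, one subtraction at a time. -/
theorem exists_sum_two_squares {r a m : M} (h : a * m = r * r + 1) :
    ∃ x y u v, a = x * x + y * y ∧ m = u * u + v * v ∧ r = x * u + y * v := by
  suffices key : ∀ r : M, ∀ a ≤ r * r + 1, ∀ m ≤ r * r + 1, a * m = r * r + 1 →
      ∃ x ≤ a, ∃ y ≤ a, ∃ u ≤ m, ∃ v ≤ m,
      a = x * x + y * y ∧ m = u * u + v * v ∧ r = x * u + y * v by
    obtain ⟨x, -, y, -, u, -, v, -, h⟩ := key r a (le_of_dvd (by positivity) ⟨m, h.symm⟩) m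
      (le_of_dvd (by positivity) ⟨a, by rw [← h, mul_comm]⟩) h
    exact ⟨x, y, u, v, h⟩
  have le_sum : ∀ x y : M, x ≤ x * x + y * y ∧ y ≤ x * x + y * y := by
    have le_sq : ∀ x : M, x ≤ x * x := fun x => by
      rcases eq_zero_or_pos x with rfl | hx
      · simp
      · exact le_mul_of_pos hx
    exact fun x y => ⟨(le_sq x).trans (le_add_of_nonneg_right zero_le),
      (le_sq y).trans (le_add_of_nonneg_left zero_le)⟩
  refine strong_induct ?_ fun r ih => ?_
  · apply_rules (maxDepth := 200) [Delta0Def.ball, Delta0Def.bex, Delta0Def.and,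
      Delta0Def.eq, Delta0Def.imp, TermDef.add, TermDef.mul, TermDef.var, TermDef.const]
  · have step : ∀ a m, a ≤ m → a * m = r * r + 1 →
        ∃ x y u v, a = x * x + y * y ∧ m = u * u + v * v ∧ r = x * u + y * v := by
      intro a m ham h
      have ha : 0 < a := pos_iff_ne_zero.2 fun h0 => by
        rw [h0, zero_mul] at h
        exact (by positivity : 0 < r * r + 1).ne h
      rcases lt_or_ge r a with hra | hra
      · have hle : (r + 1) * (r + 1) ≤ r * r + 1 := by
          rw [← h]
          have := add_one_le_iff.2 hra
          gcongr
          exact this.trans ham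
        have hr : r = 0 := by
          have : r * r + 1 + (r + r) ≤ r * r + 1 + 0 := by
            calc r * r + 1 + (r + r) = (r + 1) * (r + 1) := by ring
              _ ≤ r * r + 1 + 0 := by simpa using hle
          have := le_of_add_le_add_left this
          exact le_antisymm ((le_add_of_nonneg_right zero_le).trans this) zero_le
        subst hr
        have ha1 : a = 1 := le_antisymm (le_of_dvd one_pos ⟨m, by rw [h]; ring⟩)
          (BoundedArith.one_le_of_pos a ha)
        subst ha1
        exact ⟨1, 0, 0, 1, by ring, by simpa using h, by ring⟩
      · obtain ⟨s, rfl⟩ := exists_add_of_le hra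
        have hlt : a + (s + s) < m := by
          refine lt_of_mul_lt_mul_left ?_ ha.le
          rw [h]
          calc a * (a + (s + s)) < a * (a + (s + s)) + (s * s + 1) :=
                lt_add_of_pos_right _ (by positivity)
            _ = _ := by ring
        obtain ⟨m', rfl⟩ := exists_add_of_le hlt.le
        have h' : a * m' = s * s + 1 := by
          refine add_left_cancel (a := a * (a + (s + s))) ?_
          rw [← mul_add, h]
          ring
        obtain ⟨x, -, y, -, u, -, v, -, h1, h2, h3⟩ := ih s (lt_add_of_pos_left s ha) a
          (le_of_dvd (by positivity) ⟨m', h'.symm⟩) m'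
          (le_of_dvd (by positivity) ⟨a, by rw [← h', mul_comm]⟩) h'
        refine ⟨x, y, u + x, v + y, h1, ?_, ?_⟩
        · rw [h1, h2, h3]; ring
        · rw [h1, h3]; ring
    intro a _ m _ h
    have key : ∃ x y u v, a = x * x + y * y ∧ m = u * u + v * v ∧ r = x * u + y * v := by
      rcases le_total a m with ham | ham
      · exact step a m ham h
      · obtain ⟨x, y, u, v, h1, h2, h3⟩ := step m a ham (by rw [← h, mul_comm])
        exact ⟨u, v, x, y, h2, h1, by rw [h3]; ring⟩
    obtain ⟨x, y, u, v, h1, h2, h3⟩ := key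
    exact ⟨x, h1 ▸ (le_sum x y).1, y, h1 ▸ (le_sum x y).2, u, h2 ▸ (le_sum u v).1, v,
      h2 ▸ (le_sum u v).2, h1, h2, h3⟩

end BoundedArith

/-! ### The ring of integers of a model -/

section Integers

variable (M : Type*) [CommSemiring M] [LinearOrder M] [BoundedArith M]

/-- In the algebra of pairs `x + y ω` with `ω ^ 2 = 1`, the congruence `ω ≡ -1`. -/
def integersCon : RingCon (QuadraticAlgebra M 1 0) :=
  have trans : ∀ {x y z : QuadraticAlgebra M 1 0}, x.re + y.im = y.re + x.im →
      y.re + z.im = z.re + y.im → x.re + z.im = z.re + x.im := by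
    intro x y z h h'
    refine add_right_cancel (b := y.re + y.im) ?_
    calc x.re + z.im + (y.re + y.im) = (x.re + y.im) + (y.re + z.im) := by ring
      _ = (y.re + x.im) + (z.re + y.im) := by rw [h, h']
      _ = _ := by ring
  have mul : ∀ {x y : QuadraticAlgebra M 1 0} (z : QuadraticAlgebra M 1 0),
      x.re + y.im = y.re + x.im → (z * x).re + (z * y).im = (z * y).re + (z * x).im := by
    intro x y z h
    simp only [QuadraticAlgebra.re_mul, QuadraticAlgebra.im_mul]
    calc _ = z.re * (x.re + y.im) + z.im * (y.re + x.im) := by ring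
      _ = z.re * (y.re + x.im) + z.im * (x.re + y.im) := by rw [h]
      _ = _ := by ring
  { r := fun x y => x.re + y.im = y.re + x.im
    iseqv := ⟨fun _ => rfl, fun h => h.symm, trans⟩
    add' := by
      intro x y z w h h'
      simp only [QuadraticAlgebra.re_add, QuadraticAlgebra.im_add]
      calc _ = (x.re + y.im) + (z.re + w.im) := by ring
        _ = (y.re + x.im) + (w.re + z.im) := by rw [h, h']
        _ = _ := by ring
    mul' := by
      intro x y z w h h'
      refine trans (mul x h') ?_
      rw [mul_comm x w, mul_comm y w]
      exact mul w h }

/-- The ring of integers of `M`: formal differences of elements of `M`.  It is realised as the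
quotient of the algebra of pairs `x + y ω` with `ω ^ 2 = 1` by `ω ≡ -1`. -/
def Integers : Type _ := (integersCon M).Quotient

namespace Integers

noncomputable instance : CommSemiring (Integers M) :=
  inferInstanceAs (CommSemiring (integersCon M).Quotient)

/-- The class of the formal difference `x - y`. -/
def mk (x y : M) : Integers M := (integersCon M).toQuotient ⟨x, y⟩

variable {M}

theorem mk_eq_mk {x y z w : M} : mk M x y = mk M z w ↔ x + w = z + y :=
  RingCon.eq _

theorem exists_eq_mk (x : Integers M) : ∃ y z : M, x = mk M y z := by
  obtain ⟨⟨y, z⟩, rfl⟩ := Quotient.exists_rep x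
  exact ⟨y, z, rfl⟩

theorem mk_add_mk (x y z w : M) : mk M x y + mk M z w = mk M (x + z) (y + w) := rfl

theorem mk_mul_mk (x y z w : M) :
    mk M x y * mk M z w = mk M (x * z + y * w) (x * w + y * z) := by
  change (integersCon M).toQuotient _ = (integersCon M).toQuotient _
  congr 1
  ext <;> simp

theorem zero_def : (0 : Integers M) = mk M 0 0 := rfl

noncomputable instance : Neg (Integers M) :=
  ⟨fun x => mk M 0 1 * x⟩

noncomputable instance : CommRing (Integers M) :=
  { (inferInstance : CommSemiring (Integers M)) with
    zsmul := zsmulRec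
    neg_add_cancel := by
      intro x
      obtain ⟨y, z, rfl⟩ := exists_eq_mk x
      change mk M 0 1 * mk M y z + mk M y z = 0
      rw [mk_mul_mk, mk_add_mk, zero_def, mk_eq_mk]
      ring }

variable (M) in
/-- The embedding of `M` in its ring of integers. -/
noncomputable def ofNonneg : M →+* Integers M where
  toFun x := mk M x 0
  map_zero' := rfl
  map_one' := rfl
  map_add' x y := by rw [mk_add_mk, add_zero]
  map_mul' x y := by rw [mk_mul_mk]; simp

theorem ofNonneg_injective : Function.Injective (ofNonneg M) := fun x y h => by
  simpa using mk_eq_mk.1 h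

theorem mk_eq_sub (x y : M) : mk M x y = ofNonneg M x - ofNonneg M y := by
  rw [eq_sub_iff_add_eq]
  change mk M x y + mk M y 0 = mk M x 0
  rw [mk_add_mk, mk_eq_mk]
  ring

theorem exists_eq_or_eq_neg (x : Integers M) : ∃ y, x = ofNonneg M y ∨ x = -ofNonneg M y := by
  obtain ⟨y, z, rfl⟩ := exists_eq_mk x
  rw [mk_eq_sub]
  rcases le_total y z with h | h <;> obtain ⟨w, rfl⟩ := exists_add_of_le h
  · exact ⟨w, .inr (by simp)⟩
  · exact ⟨w, .inl (by simp)⟩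

variable (M) in
/-- The elements of `M` as the cone of non-negative integers. -/
noncomputable def cone : RingCone (Integers M) where
  __ := (ofNonneg M).rangeS
  eq_zero_of_mem_of_neg_mem' := by
    rintro _ ⟨x, rfl⟩ ⟨y, hy⟩
    have h : x + y = 0 := ofNonneg_injective (by rw [map_add, hy, map_zero, add_neg_cancel])
    rw [(add_eq_zero.1 h).1, map_zero]

theorem mem_cone {x : Integers M} : x ∈ cone M ↔ ∃ y, ofNonneg M y = x := Iff.rfl

instance : HasMemOrNegMem (cone M) where
  mem_or_neg_mem x := by
    obtain ⟨y, rfl | rfl⟩ := exists_eq_or_eq_neg x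
    · exact .inl ⟨y, rfl⟩
    · exact .inr ⟨y, by simp⟩

open Classical in
noncomputable instance : LinearOrder (Integers M) := .mkOfAddGroupCone (cone M)

instance : Nontrivial (Integers M) := ofNonneg_injective.nontrivial

instance : IsDomain (Integers M) := by
  have : NoZeroDivisors (Integers M) := ⟨fun {x y} h => by
    have key : ∀ x y : M, ofNonneg M x * ofNonneg M y = 0 →
        ofNonneg M x = 0 ∨ ofNonneg M y = 0 := fun x y h => by
      rw [← map_mul, ← map_zero (ofNonneg M)] at h
      refine (mul_eq_zero.1 (ofNonneg_injective h)).imp ?_ ?_ <;> rintro rfl <;> simp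
    obtain ⟨x, rfl | rfl⟩ := exists_eq_or_eq_neg x <;>
      obtain ⟨y, rfl | rfl⟩ := exists_eq_or_eq_neg y <;>
      simpa using key x y (by simpa using h)⟩
  exact NoZeroDivisors.to_isDomain _

instance : IsStrictOrderedRing (Integers M) :=
  have : IsOrderedRing (Integers M) := .mkOfCone (cone M)
  IsOrderedRing.toIsStrictOrderedRing _

theorem nonneg_iff {x : Integers M} : 0 ≤ x ↔ ∃ y, ofNonneg M y = x := by
  rw [← mem_cone]
  change x - 0 ∈ cone M ↔ _
  rw [sub_zero]

theorem ofNonneg_nonneg (x : M) : 0 ≤ ofNonneg M x := nonneg_iff.2 ⟨x, rfl⟩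

theorem ofNonneg_le {x y : M} : ofNonneg M x ≤ ofNonneg M y ↔ x ≤ y := by
  have mono : Monotone (ofNonneg M) := fun x y h => by
    obtain ⟨z, rfl⟩ := exists_add_of_le h
    rw [map_add]
    exact le_add_of_nonneg_right (ofNonneg_nonneg z)
  exact (mono.strictMono_of_injective ofNonneg_injective).le_iff_le

theorem ofNonneg_dvd {x y : M} : ofNonneg M x ∣ ofNonneg M y ↔ x ∣ y := by
  refine ⟨?_, fun h => map_dvd _ h⟩
  rintro ⟨z, hz⟩
  obtain ⟨z, rfl | rfl⟩ := exists_eq_or_eq_neg z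
  · exact ⟨z, ofNonneg_injective (by rw [hz, map_mul])⟩
  · have h : y + x * z = 0 := ofNonneg_injective (by rw [map_add, map_mul, hz, map_zero]; ring)
    rw [(add_eq_zero.1 h).1]
    exact dvd_zero x

theorem isUnit_ofNonneg {x : M} : IsUnit (ofNonneg M x) ↔ x = 1 := by
  refine ⟨fun h => ?_, fun h => by simp [h]⟩
  have h1 : x ∣ 1 := ofNonneg_dvd.1 (by rw [map_one]; exact h.dvd)
  have h0 : 0 < x := pos_iff_ne_zero.2 fun h0 => one_ne_zero (zero_dvd_iff.1 (h0 ▸ h1))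
  exact le_antisymm (le_of_dvd one_pos h1) (BoundedArith.one_le_of_pos x h0)

theorem squarefree_ofNonneg {x : M} : Squarefree (ofNonneg M x) ↔ SquareFree x := by
  refine ⟨fun h y hy => isUnit_ofNonneg.1 (h _ (by rw [← map_mul]; exact map_dvd _ hy)),
    fun h y hy => ?_⟩
  obtain ⟨y, rfl | rfl⟩ := exists_eq_or_eq_neg y
  · exact isUnit_ofNonneg.2 (h y (ofNonneg_dvd.1 (by rwa [map_mul])))
  · exact (isUnit_ofNonneg.2 (h y (ofNonneg_dvd.1 (by rwa [map_mul, ← neg_mul_neg])))).neg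

/-- For an even predicate it suffices to look for non-negative witnesses. -/
theorem exists_iff_exists_ofNonneg (P : Integers M → Prop) (hP : ∀ t, P (-t) ↔ P t) :
    (∃ t, P t) ↔ ∃ t : M, P (ofNonneg M t) := by
  refine ⟨fun ⟨t, ht⟩ => ?_, fun ⟨t, ht⟩ => ⟨_, ht⟩⟩
  obtain ⟨t, rfl | rfl⟩ := exists_eq_or_eq_neg t
  · exact ⟨t, ht⟩
  · exact ⟨t, (hP _).1 ht⟩

theorem cong_iff {x y n : M} : Cong x y n ↔ ofNonneg M n ∣ ofNonneg M x - ofNonneg M y := by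
  constructor
  · rintro ⟨m, rfl | rfl⟩
    · exact ⟨ofNonneg M m, by rw [map_add, map_mul]; ring⟩
    · exact ⟨-ofNonneg M m, by rw [map_add, map_mul]; ring⟩
  · rintro ⟨m, hm⟩
    obtain ⟨m, rfl | rfl⟩ := exists_eq_or_eq_neg m
    · exact ⟨m, .inl (ofNonneg_injective (by rw [map_add, map_mul, mul_comm, ← hm]; ring))⟩
    · refine ⟨m, .inr (ofNonneg_injective ?_)⟩
      rw [map_add, map_mul]
      linear_combination -hm

instance : IsBezout (Integers M) := by
  have key : ∀ x y : M, (Ideal.span {ofNonneg M x, ofNonneg M y}).IsPrincipal := by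
    intro a b
    rcases eq_zero_or_pos a with rfl | ha
    · exact ⟨ofNonneg M b, by simp [Ideal.span_insert]⟩
    rcases eq_zero_or_pos b with rfl | hb
    · exact ⟨ofNonneg M a, by simp [Ideal.span_insert]⟩
    obtain ⟨g, x, y, hga, hgb, h⟩ := exists_bezout ha hb
    refine ⟨ofNonneg M g, le_antisymm ?_ ?_⟩
    · rw [Ideal.span_le, Set.insert_subset_iff, Set.singleton_subset_iff]
      exact ⟨Ideal.mem_span_singleton.2 (map_dvd _ hga),
        Ideal.mem_span_singleton.2 (map_dvd _ hgb)⟩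
    · change Ideal.span _ ≤ _
      rw [Ideal.span_singleton_le_iff_mem, Ideal.mem_span_pair]
      rcases h with h | h <;> have h := congrArg (ofNonneg M) h <;>
        simp only [map_add, map_mul] at h
      · exact ⟨ofNonneg M x, -ofNonneg M y, by linear_combination h⟩
      · exact ⟨-ofNonneg M x, ofNonneg M y, by linear_combination h⟩
  rw [IsBezout.iff_span_pair_isPrincipal]
  intro x y
  obtain ⟨x, rfl | rfl⟩ := exists_eq_or_eq_neg x <;>
    obtain ⟨y, rfl | rfl⟩ := exists_eq_or_eq_neg y <;>
    simpa [Ideal.span_insert, Ideal.span_singleton_neg] using key x y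

end Integers

end Integers

/-! ### Congruence conditions in Bézout domains -/

section Bezout

variable {R : Type*} [CommRing R]

/-- A square multiple of `A` being a square modulo `n`, so is `A`, if the multiplier is coprime to
`n`. -/
theorem exists_dvd_sq_sub {A n t u : R} (hu : IsCoprime u n) (h : n ∣ t ^ 2 - A * u ^ 2) :
    ∃ s, n ∣ s ^ 2 - A := by
  obtain ⟨v, w, hvw⟩ := hu
  obtain ⟨k, hk⟩ := h
  refine ⟨t * v, v ^ 2 * k - A * w * (u * v + 1), ?_⟩
  linear_combination v ^ 2 * hk + A * (u * v + 1) * hvw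

/-- Square roots modulo coprime `m` and `n` combine to one modulo `m * n`. -/
theorem exists_dvd_sq_sub_mul {A m n s t : R} (hmn : IsCoprime m n) (hs : m ∣ s ^ 2 - A)
    (ht : n ∣ t ^ 2 - A) : ∃ u, m * n ∣ u ^ 2 - A := by
  obtain ⟨v, w, hvw⟩ := hmn
  have h1 : m ∣ (t * (v * m) + s * (w * n)) ^ 2 - A := by
    rw [show (t * (v * m) + s * (w * n)) ^ 2 - A = (s ^ 2 - A) +
      m * (v * (t - s) * (t * (v * m) + s * (w * n) + s)) by
        linear_combination (s * (t * (v * m) + s * (w * n) + s)) * hvw]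
    exact hs.add (dvd_mul_right _ _)
  have h2 : n ∣ (t * (v * m) + s * (w * n)) ^ 2 - A := by
    rw [show (t * (v * m) + s * (w * n)) ^ 2 - A = (t ^ 2 - A) +
      n * (w * (s - t) * (t * (v * m) + s * (w * n) + t)) by
        linear_combination (t * (t * (v * m) + s * (w * n) + t)) * hvw]
    exact ht.add (dvd_mul_right _ _)
  exact ⟨_, IsCoprime.mul_dvd ⟨v, w, hvw⟩ h1 h2⟩

variable [IsDomain R] [IsBezout R]

/-- A non-trivial solution can be divided by `gcd(x, y)`, whose square divides `z ^ 2`. -/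
theorem exists_primitive_solution {a b x y z : R} (h0 : ¬ (x = 0 ∧ y = 0 ∧ z = 0))
    (h : a * x ^ 2 + b * y ^ 2 = z ^ 2) :
    ∃ x y z, IsCoprime x y ∧ a * x ^ 2 + b * y ^ 2 = z ^ 2 := by
  obtain ⟨x', hx⟩ := IsBezout.gcd_dvd_left x y
  obtain ⟨y', hy⟩ := IsBezout.gcd_dvd_right x y
  obtain ⟨u, v, huv⟩ := IsBezout.gcd_eq_sum x y
  set g := IsBezout.gcd x y
  have hg0 : g ≠ 0 := by
    intro hg0
    rw [hg0, zero_mul] at hx hy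
    refine h0 ⟨hx, hy, ?_⟩
    rw [hx, hy] at h
    simpa using h.symm
  have hz : g ∣ z := by
    rw [← IsIntegrallyClosed.pow_dvd_pow_iff two_ne_zero, ← h, hx, hy]
    exact ⟨a * x' ^ 2 + b * y' ^ 2, by ring⟩
  obtain ⟨z', hz⟩ := hz
  refine ⟨x', y', z', ⟨u, v, mul_left_cancel₀ hg0 ?_⟩, mul_left_cancel₀ (pow_ne_zero 2 hg0) ?_⟩
  · linear_combination huv - u * hx - v * hy
  · rw [hx, hy, hz] at h
    linear_combination h

/-- In a primitive solution a common divisor of `x` and `b` divides `z`, so its square divides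
`b * y ^ 2`; as `b` is square-free, it divides `y`. -/
theorem isCoprime_of_solution {a b x y z : R} (hb : Squarefree b) (hxy : IsCoprime x y)
    (h : a * x ^ 2 + b * y ^ 2 = z ^ 2) : IsCoprime x b := by
  refine IsRelPrime.isCoprime fun g hgx hgb => ?_
  have hg : Squarefree g := hb.squarefree_of_dvd hgb
  have hgz : g ∣ z := by
    rw [← hg.dvd_pow_iff_dvd two_ne_zero, ← h]
    exact ((hgx.pow two_ne_zero).mul_left a).add (hgb.mul_right _)
  have hgy : g * g ∣ b * y ^ 2 := by
    rw [eq_sub_of_add_eq' h, ← sq]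
    exact (pow_dvd_pow_of_dvd hgz 2).sub ((pow_dvd_pow_of_dvd hgx 2).mul_left a)
  have hgy : g ∣ y := (hg.dvd_pow_iff_dvd two_ne_zero).1
    (Squarefree.dvd_of_squarefree_of_mul_dvd_mul_right hb hgy)
  exact hxy.isUnit_of_dvd' hgx hgy

/-- Legendre's conditions are necessary. -/
theorem legendre_conditions_of_solution {a b x y z : R} (ha : Squarefree a) (hb : Squarefree b)
    (h0 : ¬ (x = 0 ∧ y = 0 ∧ z = 0)) (h : a * x ^ 2 + b * y ^ 2 = z ^ 2) :
    (∃ t, b ∣ t ^ 2 - a) ∧ (∃ t, a ∣ t ^ 2 - b) ∧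
      ∀ d a' b', a = d * a' → b = d * b' → ∃ t, d ∣ t ^ 2 + a' * b' := by
  obtain ⟨x, y, z, hxy, h⟩ := exists_primitive_solution h0 h
  have hx : IsCoprime x b := isCoprime_of_solution hb hxy h
  have hy : IsCoprime y a := isCoprime_of_solution ha hxy.symm (by rw [add_comm, h])
  refine ⟨exists_dvd_sq_sub (t := z) hx ⟨y ^ 2, by linear_combination -h⟩,
    exists_dvd_sq_sub (t := z) hy ⟨x ^ 2, by linear_combination -h⟩, ?_⟩
  intro d a' b' had hbd
  have hd : Squarefree d := ha.squarefree_of_dvd ⟨a', had⟩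
  have hdz : d ∣ z := by
    rw [← hd.dvd_pow_iff_dvd two_ne_zero, ← h, had, hbd]
    exact ⟨a' * x ^ 2 + b' * y ^ 2, by ring⟩
  obtain ⟨z', rfl⟩ := hdz
  have key : a' * x ^ 2 + b' * y ^ 2 = d * z' ^ 2 := by
    refine mul_left_cancel₀ hd.ne_zero ?_
    rw [had, hbd] at h
    linear_combination h
  obtain ⟨t, ht⟩ := exists_dvd_sq_sub (A := -(a' * b')) (t := a' * x)
    (hy.of_isCoprime_of_dvd_right ⟨a', had⟩) ⟨a' * z' ^ 2, by linear_combination a' * key⟩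
  exact ⟨t, by rwa [sub_neg_eq_add] at ht⟩

/-- The first of Legendre's conditions is inherited by the coefficients `A, b` of the smaller
equation, where `c ^ 2 = b + a * A * m ^ 2`. -/
theorem exists_dvd_sq_sub_descent {a b A c m d a' b' t : R} (ha : Squarefree a)
    (hb : Squarefree b) (hc : c ^ 2 = b + a * A * m ^ 2) (had : a = d * a') (hbd : b = d * b')
    (hab : IsCoprime a' b') (ht : d ∣ t ^ 2 + a' * b') (hs : ∃ s, b ∣ s ^ 2 - a) :
    ∃ s, b ∣ s ^ 2 - A := by
  obtain ⟨s, hs⟩ := hs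
  have hda : IsCoprime d a' := (IsRelPrime.of_squarefree_mul (had ▸ ha)).isCoprime
  have hdb : IsCoprime d b' := (IsRelPrime.of_squarefree_mul (hbd ▸ hb)).isCoprime
  have hd : Squarefree d := ha.squarefree_of_dvd ⟨a', had⟩
  have hdc : d ∣ c := by
    rw [← hd.dvd_pow_iff_dvd two_ne_zero, hc, had, hbd]
    exact ⟨b' + a' * A * m ^ 2, by ring⟩
  obtain ⟨c', hc'⟩ := hdc
  have key : d * c' ^ 2 = b' + a' * A * m ^ 2 := by
    refine mul_left_cancel₀ hd.ne_zero ?_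
    rw [had, hbd, hc'] at hc
    linear_combination hc
  have hmd : IsCoprime m d := by
    refine IsRelPrime.isCoprime fun g hgm hgd => hdb.isUnit_of_dvd' hgd ?_
    rw [← sub_eq_of_eq_add key]
    exact (hgd.mul_right _).sub ((hgm.pow two_ne_zero).mul_left _)
  have hmb : IsCoprime m b' := by
    refine IsRelPrime.isCoprime fun g hgm hgb => hb g ?_
    have hgb : g ∣ b := hbd ▸ hgb.mul_left d
    have hgc : g ∣ c := by
      rw [← (hb.squarefree_of_dvd hgb).dvd_pow_iff_dvd two_ne_zero, hc]
      exact hgb.add ((hgm.pow two_ne_zero).mul_left _)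
    rw [← sub_eq_of_eq_add hc, ← sq]
    exact (pow_dvd_pow_of_dvd hgc 2).sub ((pow_dvd_pow_of_dvd hgm 2).mul_left _)
  -- modulo `d` use the third condition for `a, b`, modulo `b'` use the first one
  have h1 : ∃ u, d ∣ u ^ 2 - A := by
    obtain ⟨k, hk⟩ := ht
    refine exists_dvd_sq_sub (t := t) (hda.symm.mul_left hmd) ⟨k - a' * c' ^ 2, ?_⟩
    linear_combination hk + a' * key
  have hsb : IsCoprime s b' := by
    have hsa : IsCoprime a b' := by rw [had]; exact hdb.mul_left hab
    obtain ⟨k, hk⟩ := hs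
    have : IsCoprime (s ^ 2) b' := by
      rw [eq_add_of_sub_eq hk, hbd, add_comm, mul_assoc, mul_left_comm]
      exact hsa.add_mul_left_left _
    exact this.of_isCoprime_of_dvd_left (dvd_pow_self s two_ne_zero)
  have h2 : ∃ u, b' ∣ u ^ 2 - A := by
    obtain ⟨k, hk⟩ := hs
    refine exists_dvd_sq_sub (t := c) (hsb.mul_left hmb) ⟨d - A * m ^ 2 * d * k, ?_⟩
    linear_combination hc - A * m ^ 2 * hk + (1 - A * m ^ 2 * k) * hbd
  obtain ⟨u, hu⟩ := h1
  obtain ⟨v, hv⟩ := h2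
  rw [hbd]
  exact exists_dvd_sq_sub_mul hdb hu hv

/-- The third of Legendre's conditions for the coefficients `A, b` of the smaller equation, where
`c ^ 2 = b + a * A * m ^ 2`. -/
theorem exists_dvd_sq_add_descent {a b A c m r A' b' : R} (hb : Squarefree b)
    (hc : c ^ 2 = b + a * A * m ^ 2) (hA : A = r * A') (hbr : b = r * b')
    (hs : ∃ s, b ∣ s ^ 2 - a) : ∃ t, r ∣ t ^ 2 + A' * b' := by
  obtain ⟨s, k, hk⟩ := hs
  have hr : Squarefree r := hb.squarefree_of_dvd ⟨b', hbr⟩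
  have hrc : r ∣ c := by
    rw [← hr.dvd_pow_iff_dvd two_ne_zero, hc, hA, hbr]
    exact ⟨b' + a * A' * m ^ 2, by ring⟩
  obtain ⟨c', hc'⟩ := hrc
  have key : r * c' ^ 2 = b' + a * A' * m ^ 2 := by
    refine mul_left_cancel₀ hr.ne_zero ?_
    rw [hA, hbr, hc'] at hc
    linear_combination hc
  refine ⟨s * A' * m, A' ^ 2 * m ^ 2 * b' * k + A' * c' ^ 2, ?_⟩
  linear_combination A' ^ 2 * m ^ 2 * hk - A' * key + A' ^ 2 * m ^ 2 * k * hbr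

end Bezout

/-! ### Legendre's conditions in a model -/

section Conditions

theorem NormConditions.symm {M : Type*} [CommSemiring M] {a b : M} (h : NormConditions a b) : NormConditions b a := by
  obtain ⟨hab, hba, d, e, ⟨h1, h2, h3⟩, he, hd⟩ := h
  exact ⟨hba, hab, d, e, ⟨h2, h1, fun t ht ht' => h3 t ht' ht⟩, by rw [he, mul_comm], hd⟩

variable {M : Type*} [CommSemiring M] [LinearOrder M] [BoundedArith M]

open Integers

theorem isCoprime_ofNonneg_iff {a b : M} :
    IsCoprime (ofNonneg M a) (ofNonneg M b) ↔ ∀ g : M, g ∣ a → g ∣ b → g = 1 := by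
  rw [← isRelPrime_iff_isCoprime]
  refine ⟨fun h g ha hb => isUnit_ofNonneg.1 (h (map_dvd _ ha) (map_dvd _ hb)), fun h g ha hb => ?_⟩
  obtain ⟨g, rfl | rfl⟩ := exists_eq_or_eq_neg g
  · exact isUnit_ofNonneg.2 (h g (ofNonneg_dvd.1 ha) (ofNonneg_dvd.1 hb))
  · rw [neg_dvd] at ha hb
    exact (isUnit_ofNonneg.2 (h g (ofNonneg_dvd.1 ha) (ofNonneg_dvd.1 hb))).neg

theorem squareMod_iff {a b : M} :
    SquareMod a b ↔ ∃ t, ofNonneg M b ∣ t ^ 2 - ofNonneg M a := by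
  rw [exists_iff_exists_ofNonneg _ (fun t => by rw [neg_sq])]
  exact exists_congr fun t => by rw [cong_iff, map_mul, sq]

theorem negSquareMod_iff {e d : M} :
    NegSquareMod e d ↔ ∃ t, ofNonneg M d ∣ t ^ 2 + ofNonneg M e := by
  rw [exists_iff_exists_ofNonneg _ (fun t => by rw [neg_sq])]
  exact exists_congr fun t => by rw [cong_iff, map_add, map_mul, map_zero, sub_zero, sq]

/-- Legendre's conditions as divisibilities between integers. -/
theorem normConditions_iff {a b : M} (ha : 0 < a) :
    NormConditions a b ↔ (∃ t, ofNonneg M b ∣ t ^ 2 - ofNonneg M a) ∧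
      (∃ t, ofNonneg M a ∣ t ^ 2 - ofNonneg M b) ∧
      ∃ d a' b' : M, a = d * a' ∧ b = d * b' ∧ IsCoprime (ofNonneg M a') (ofNonneg M b') ∧
        ∃ t, ofNonneg M d ∣ t ^ 2 + ofNonneg M a' * ofNonneg M b' := by
  rw [← squareMod_iff, ← squareMod_iff]
  refine and_congr_right' (and_congr_right' ⟨?_, ?_⟩)
  · rintro ⟨d, e, ⟨⟨a', rfl⟩, ⟨b', rfl⟩, hd⟩, he, hed⟩
    have hd0 : 0 < d := pos_of_mul_pos_left ha zero_le
    have he : e = a' * b' := by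
      refine mul_right_cancel₀ (mul_pos hd0 hd0).ne' ?_
      rw [he]; ring
    rw [negSquareMod_iff, he, map_mul] at hed
    refine ⟨d, a', b', rfl, rfl, isCoprime_ofNonneg_iff.2 fun g hga hgb => ?_, hed⟩
    obtain ⟨k, hk⟩ : d * g ∣ d := hd _ (mul_dvd_mul_left d hga) (mul_dvd_mul_left d hgb)
    have hg : g ∣ 1 := ⟨k, mul_left_cancel₀ hd0.ne' (by rw [mul_one, ← mul_assoc, ← hk])⟩
    have hg0 : 0 < g := pos_iff_ne_zero.2 fun h0 => one_ne_zero (zero_dvd_iff.1 (h0 ▸ hg))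
    exact le_antisymm (le_of_dvd one_pos hg) (BoundedArith.one_le_of_pos g hg0)
  · rintro ⟨d, a', b', rfl, rfl, ⟨u, v, huv⟩, h⟩
    refine ⟨d, a' * b', ⟨⟨a', rfl⟩, ⟨b', rfl⟩, fun t hta htb => ?_⟩, by ring, ?_⟩
    · refine ofNonneg_dvd.1 ?_
      have hta := map_dvd (ofNonneg M) (divides_iff.1 hta)
      have htb := map_dvd (ofNonneg M) (divides_iff.1 htb)
      rw [map_mul] at hta htb
      rw [show ofNonneg M d = ofNonneg M d * ofNonneg M a' * u + ofNonneg M d * ofNonneg M b' * v by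
        linear_combination -ofNonneg M d * huv]
      exact (hta.mul_right u).add (htb.mul_right v)
    · rwa [negSquareMod_iff, map_mul]

/-- Division by the greatest common divisor. -/
theorem exists_eq_mul_isCoprime {a b : M} (ha : 0 < a) (hb : 0 < b) :
    ∃ g a' b', a = g * a' ∧ b = g * b' ∧ IsCoprime (ofNonneg M a') (ofNonneg M b') := by
  obtain ⟨g, x, y, ⟨a', rfl⟩, ⟨b', rfl⟩, hg⟩ := exists_bezout ha hb
  have hg0 : ofNonneg M g ≠ 0 := by
    rw [map_ne_zero_iff _ ofNonneg_injective]
    rintro rfl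
    simp at ha
  refine ⟨g, a', b', rfl, rfl, ?_⟩
  rcases hg with hg | hg <;> have hg := congrArg (ofNonneg M) hg <;>
    simp only [map_add, map_mul] at hg
  · refine ⟨ofNonneg M x, -ofNonneg M y, mul_left_cancel₀ hg0 ?_⟩
    linear_combination hg
  · refine ⟨-ofNonneg M x, ofNonneg M y, mul_left_cancel₀ hg0 ?_⟩
    linear_combination hg

theorem normConditions_of_isSolution {a b x y z : M} (ha : 0 < a) (hb : 0 < b)
    (hsa : SquareFree a) (hsb : SquareFree b) (h : IsSolution a b x y z) : NormConditions a b := by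
  obtain ⟨h0, h⟩ := h
  obtain ⟨h1, h2, h3⟩ := legendre_conditions_of_solution (squarefree_ofNonneg.2 hsa)
    (squarefree_ofNonneg.2 hsb) (x := ofNonneg M x) (y := ofNonneg M y) (z := ofNonneg M z)
    (by simpa only [map_eq_zero_iff _ ofNonneg_injective] using h0)
    (by have h := congrArg (ofNonneg M) h
        simp only [map_add, map_mul] at h
        linear_combination h)
  rw [normConditions_iff ha]
  refine ⟨h1, h2, ?_⟩
  obtain ⟨g, a', b', rfl, rfl, hab⟩ := exists_eq_mul_isCoprime ha hb
  exact ⟨g, a', b', rfl, rfl, hab, h3 _ _ _ (map_mul _ _ _) (map_mul _ _ _)⟩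

/-- The smaller equation in Legendre's descent satisfies Legendre's conditions. -/
theorem NormConditions.descent {a b A c m : M} (ha : 0 < a) (hA : 0 < A) (hb : 0 < b)
    (hsa : SquareFree a) (hsb : SquareFree b) (h : NormConditions a b)
    (hc : c * c = b + a * A * (m * m)) : NormConditions A b := by
  have hc := congrArg (ofNonneg M) hc
  simp only [map_add, map_mul, ← sq, map_pow] at hc
  obtain ⟨h1, h2, d, a', b', had, hbd, hab, t, ht⟩ := (normConditions_iff ha).1 h
  have hsa := squarefree_ofNonneg.2 hsa
  have hsb := squarefree_ofNonneg.2 hsb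
  rw [normConditions_iff hA]
  refine ⟨exists_dvd_sq_sub_descent hsa hsb hc (by rw [had, map_mul]) (by rw [hbd, map_mul]) hab ht
    h1, ⟨ofNonneg M c, ofNonneg M a * ofNonneg M m ^ 2, by linear_combination hc⟩, ?_⟩
  obtain ⟨g, A', b', rfl, rfl, hAb⟩ := exists_eq_mul_isCoprime hA hb
  exact ⟨g, A', b', rfl, rfl, hAb,
    exists_dvd_sq_add_descent hsb hc (map_mul _ _ _) (map_mul _ _ _) h1⟩

end Conditions

/-! ### Bounded definitions of the arithmetical notions -/

section Definable

variable {M : Type*} [CommSemiring M] [LinearOrder M] [BoundedArith M]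

open Integers

variable {n : ℕ} {f g h k : (Fin n → M) → M}

theorem Delta0Def.squareFree (hf : TermDef f) : Delta0Def fun v => SquareFree (f v) := by
  refine (Delta0Def.ball (S := fun v y => y * y ∣ f v → y = 1) hf
    (by apply_rules [Delta0Def.imp, Delta0Def.dvd, Delta0Def.eq, TermDef.mul, TermDef.var,
      TermDef.const, hf.lift])).congr fun v => ⟨fun h y _ => h y, fun h y hy => ?_⟩
  refine h y ?_ hy
  rcases eq_zero_or_pos (f v) with h0 | h0
  · exact absurd (h 0 zero_le (by rw [h0]; exact dvd_zero _)) zero_ne_one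
  · refine le_of_dvd h0 ((dvd_mul_right y y).trans hy)

theorem Delta0Def.cong (hf : TermDef f) (hg : TermDef g) (hh : TermDef h) :
    Delta0Def fun v => Cong (f v) (g v) (h v) := by
  refine (Delta0Def.bex (S := fun v m => f v = g v + m * h v ∨ g v = f v + m * h v) (hf.add hg)
    (by apply_rules [Delta0Def.or, Delta0Def.eq, TermDef.mul, TermDef.add, TermDef.var, hf.lift,
      hg.lift, hh.lift])).congr fun v => ⟨?_, fun ⟨m, _, hm⟩ => ⟨m, hm⟩⟩
  rintro ⟨m, hm⟩
  rcases eq_zero_or_pos (h v) with h0 | h0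
  · exact ⟨0, zero_le, by simpa [h0] using hm⟩
  · refine ⟨m, (le_mul_of_pos h0).trans ?_, hm⟩
    rcases hm with hm | hm
    · rw [hm, add_right_comm]
      exact le_add_of_nonneg_left zero_le
    · rw [hm, ← add_assoc]
      exact le_add_of_nonneg_left zero_le

theorem Delta0Def.squareMod (hf : TermDef f) (hg : TermDef g) :
    Delta0Def fun v => SquareMod (f v) (g v) := by
  refine (Delta0Def.bex (S := fun v x => Cong (x * x) (f v) (g v)) (hf.add hg)
    (by apply_rules [Delta0Def.cong, TermDef.mul, TermDef.var, hf.lift, hg.lift])).congr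
      fun v => ⟨?_, fun ⟨x, _, hx⟩ => ⟨x, hx⟩⟩
  rintro ⟨x, hx⟩
  rcases eq_zero_or_pos (g v) with h0 | h0
  · obtain rfl | hx0 := eq_zero_or_pos x
    · exact ⟨0, zero_le, hx⟩
    · refine ⟨x, (le_mul_of_pos hx0).trans ?_, hx⟩
      obtain ⟨m, hm⟩ := hx
      rw [h0, mul_zero, add_zero, add_zero] at hm
      rw [h0, add_zero]
      exact (hm.elim id Eq.symm).le
  · obtain ⟨q, r, rfl, hr⟩ := exists_div_mod x h0
    refine ⟨r, hr.le.trans (le_add_of_nonneg_left zero_le), ?_⟩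
    rw [cong_iff] at hx ⊢
    have := hx.sub (dvd_mul_right (ofNonneg M (g v)) (ofNonneg M (g v) * ofNonneg M q ^ 2 +
      2 * ofNonneg M q * ofNonneg M r))
    refine this.trans (dvd_of_eq ?_)
    simp only [map_mul, map_add]
    ring

theorem Delta0Def.negSquareMod (hf : TermDef f) (hg : TermDef g) :
    Delta0Def fun v => NegSquareMod (f v) (g v) := by
  refine (Delta0Def.bex (S := fun v x => Cong (x * x + f v) 0 (g v)) hg
    (by apply_rules [Delta0Def.cong, TermDef.add, TermDef.mul, TermDef.var, TermDef.const, hf.lift,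
      hg.lift])).congr fun v => ⟨?_, fun ⟨x, _, hx⟩ => ⟨x, hx⟩⟩
  rintro ⟨x, hx⟩
  rcases eq_zero_or_pos (g v) with h0 | h0
  · refine ⟨x, ?_, hx⟩
    obtain ⟨m, hm⟩ := hx
    rw [h0, mul_zero, add_zero, add_zero] at hm
    have := (add_eq_zero.1 (hm.elim id Eq.symm)).1
    rw [mul_self_eq_zero.1 this]
    exact zero_le
  · obtain ⟨q, r, rfl, hr⟩ := exists_div_mod x h0
    refine ⟨r, hr.le, ?_⟩
    rw [cong_iff] at hx ⊢
    have := hx.sub (dvd_mul_right (ofNonneg M (g v)) (ofNonneg M (g v) * ofNonneg M q ^ 2 +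
      2 * ofNonneg M q * ofNonneg M r))
    refine this.trans (dvd_of_eq ?_)
    simp only [map_mul, map_add]
    ring

theorem Delta0Def.isGCD (hf : TermDef f) (hg : TermDef g) (hh : TermDef h) :
    Delta0Def fun v => IsGCD (f v) (g v) (h v) := by
  refine ((Delta0Def.dvd hf hg).and ((Delta0Def.dvd hf hh).and
    (Delta0Def.ball (S := fun v t => t ∣ g v → t ∣ h v → t ∣ f v) (hg.add hh)
    (by apply_rules [Delta0Def.imp, Delta0Def.dvd, TermDef.var, hf.lift, hg.lift,
      hh.lift])))).congr fun v => and_congr_right' (and_congr_right'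
      ⟨fun h t _ => h t, fun H t hg hh => ?_⟩)
  rcases eq_zero_or_pos (g v + h v) with h0 | h0
  · obtain ⟨hg0, hh0⟩ := add_eq_zero.1 h0
    have := H 0 zero_le (by rw [hg0]) (by rw [hh0])
    rw [zero_dvd_iff.1 this]
    exact dvd_zero t
  · exact H t (le_of_dvd h0 (dvd_add hg hh)) hg hh

/-- The positivity of `f v` bounds the greatest common divisor that occurs in Legendre's
conditions. -/
theorem Delta0Def.normConditions (hf : TermDef f) (hg : TermDef g) :
    Delta0Def fun v => 0 < f v ∧ NormConditions (f v) (g v) := by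
  refine ((Delta0Def.lt (.const 0) hf).and ((Delta0Def.squareMod hf hg).and
    ((Delta0Def.squareMod hg hf).and (Delta0Def.bex (S := fun v d => ∃ e ≤ f v * g v,
      IsGCD d (f v) (g v) ∧ e * (d * d) = f v * g v ∧ NegSquareMod e d) hf
    (by apply_rules [Delta0Def.isGCD, Delta0Def.bex, Delta0Def.and, Delta0Def.negSquareMod,
      Delta0Def.eq, TermDef.mul, TermDef.var, hf.lift, hg.lift, hf.lift.lift,
      hg.lift.lift]))))).congr fun v => ?_
  refine and_congr_right fun hf0 => and_congr_right' (and_congr_right'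
    ⟨?_, fun ⟨d, _, e, _, h⟩ => ⟨d, e, h⟩⟩)
  rintro ⟨d, e, hd, he, h⟩
  have hd0 : 0 < d := pos_iff_ne_zero.2 fun h0 => hf0.ne'
    (zero_dvd_iff.1 (h0 ▸ divides_iff.1 hd.1))
  refine ⟨d, le_of_dvd hf0 hd.1, e, ?_, hd, he, h⟩
  rw [← he]
  exact le_mul_of_pos (mul_pos hd0 hd0)

theorem Delta0Def.isBeta (hf : TermDef f) (hg : TermDef g) (hh : TermDef h) (hk : TermDef k) :
    Delta0Def fun v => IsBeta (f v) (g v) (h v) (k v) := by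
  refine (Delta0Def.bex (S := fun v q => k v < 1 + (h v + 1) * g v ∧
    f v = q * (1 + (h v + 1) * g v) + k v) hf
    (by apply_rules [Delta0Def.and, Delta0Def.lt, Delta0Def.eq, TermDef.mul, TermDef.add,
      TermDef.var, TermDef.const, hf.lift, hg.lift, hh.lift, hk.lift])).congr fun v => ?_
  constructor
  · rintro ⟨hlt, q, hq⟩
    refine ⟨q, ?_, lt_iff.1 hlt, hq⟩
    rw [hq]
    exact (le_mul_of_pos (by positivity)).trans (le_add_of_nonneg_right zero_le)
  · rintro ⟨q, -, hlt, hq⟩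
    exact ⟨lt_iff.2 hlt, q, hq⟩

end Definable

/-! ### Coded sequences of powers -/

section Powers

variable {M : Type*} [CommSemiring M] [LinearOrder M]

/-- The pair `(w, d)` codes the sequence of the powers of `x` with exponents up to `L`. -/
def IsPowSeq (x L w d : M) : Prop :=
  IsBeta w d 0 1 ∧ ∀ i, i < L → ∃ u, IsBeta w d i u ∧ IsBeta w d (i + 1) (x * u)

theorem isPow_iff {x y z : M} : IsPow x y z ↔ ∃ w d, IsPowSeq x y w d ∧ IsBeta w d y z := by
  simp only [IsPow, IsPowSeq, lt_iff, and_assoc]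

theorem IsPowSeq.mono {x L L' w d : M} (h : IsPowSeq x L w d) (hL : L' ≤ L) : IsPowSeq x L' w d :=
  ⟨h.1, fun i hi => h.2 i (hi.trans_le hL)⟩

theorem IsPowSeq.isPow {x L w d i u : M} (h : IsPowSeq x L w d) (hi : i ≤ L)
    (hu : IsBeta w d i u) : IsPow x i u :=
  isPow_iff.2 ⟨w, d, h.mono hi, hu⟩

variable [BoundedArith M]

theorem IsBeta.unique {w d i u u' : M} (h : IsBeta w d i u) (h' : IsBeta w d i u') : u = u' := by
  obtain ⟨hu, q, hq⟩ := h
  obtain ⟨hu', q', hq'⟩ := h'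
  rw [lt_iff] at hu hu'
  set n := 1 + (i + 1) * d
  have key : ∀ q q' u u' : M, u < n → q * n + u = q' * n + u' → q' ≤ q := by
    intro q q' u u' hu h
    refine lt_add_one_iff.1 (lt_of_mul_lt_mul_right (a := n) ?_ zero_le)
    calc q' * n ≤ q' * n + u' := le_add_of_nonneg_right zero_le
      _ = q * n + u := h.symm
      _ < q * n + n := by gcongr
      _ = (q + 1) * n := by ring
  have hqq : q' = q := le_antisymm (key q q' u u' hu (hq ▸ hq')) (key q' q u' u hu' (hq' ▸ hq))
  rw [hqq, hq] at hq'
  exact add_left_cancel hq'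

theorem IsBeta.le {w d i u : M} (h : IsBeta w d i u) : u ≤ w := by
  obtain ⟨-, q, rfl⟩ := h
  exact le_add_of_nonneg_left zero_le

theorem eq_zero_or_eq_add_one (i : M) : i = 0 ∨ ∃ j, i = j + 1 := by
  rcases eq_zero_or_pos i with h | h
  · exact .inl h
  · obtain ⟨j, hj⟩ := exists_add_of_le (BoundedArith.one_le_of_pos i h)
    exact .inr ⟨j, by rw [hj, add_comm]⟩

namespace IsPowSeq

variable {x x' L w d w' d' : M}

theorem succ (h : IsPowSeq x L w d) {i u : M} (hi : i < L) (hu : IsBeta w d i u) :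
    IsBeta w d (i + 1) (x * u) := by
  obtain ⟨v, hv, hv'⟩ := h.2 i hi
  rwa [hu.unique hv]

theorem exists_isBeta (h : IsPowSeq x L w d) {i : M} (hi : i ≤ L) : ∃ u, IsBeta w d i u := by
  obtain rfl | ⟨j, rfl⟩ := eq_zero_or_eq_add_one i
  · exact ⟨1, h.1⟩
  · obtain ⟨u, -, hu⟩ := h.2 j (add_one_le_iff.1 hi)
    exact ⟨_, hu⟩

theorem exists_isBeta_pred (h : IsPowSeq x L w d) {i u : M} (hi : i < L)
    (hu : IsBeta w d (i + 1) u) : ∃ v, IsBeta w d i v ∧ u = x * v := by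
  obtain ⟨v, hv, hv'⟩ := h.2 i hi
  exact ⟨v, hv, hu.unique hv'⟩

/-- Simultaneous induction along two sequences of powers. -/
theorem induct (h : IsPowSeq x L w d) (h' : IsPowSeq x' L w' d') {S : M → M → Prop}
    (hS : ∀ n : ℕ, ∀ i j : Fin n, Delta0Def fun v : Fin n → M => S (v i) (v j)) (one : S 1 1)
    (mul : ∀ u u', S u u' → S (x * u) (x' * u')) {i u u' : M} (hi : i ≤ L) (hu : IsBeta w d i u)
    (hu' : IsBeta w' d' i u') : S u u' := by
  suffices key : ∀ i : M, i ≤ L → ∀ u ≤ w, ∀ u' ≤ w', IsBeta w d i u → IsBeta w' d' i u' → S u u' from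
    key i hi u hu.le u' hu'.le hu hu'
  refine Delta0Induction.induct BoundedArith.induction ?_ ?_ ?_
  · apply_rules (maxDepth := 200) [Delta0Def.isBeta, Delta0Def.ball, Delta0Def.le, Delta0Def.imp,
      TermDef.var, TermDef.const, hS]
  · intro _ u _ u' _ hu hu'
    rwa [hu.unique h.1, hu'.unique h'.1]
  · intro i ih hi u _ u' _ hu hu'
    have hi := add_one_le_iff.1 hi
    obtain ⟨v, hv, rfl⟩ := h.exists_isBeta_pred hi hu
    obtain ⟨v', hv', rfl⟩ := h'.exists_isBeta_pred hi hu'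
    exact mul v v' (ih hi.le v hv.le v' hv'.le hv hv')

theorem le_of_le (h : IsPowSeq x L w d) (h' : IsPowSeq x' L w' d') (hx : x ≤ x') {i u u' : M}
    (hi : i ≤ L) (hu : IsBeta w d i u) (hu' : IsBeta w' d' i u') : u ≤ u' :=
  h.induct h' (S := fun u u' => u ≤ u') (fun _ i j => .le (.var i) (.var j)) le_rfl
    (fun _ _ h => mul_le_mul' hx h) hi hu hu'

theorem pos (h : IsPowSeq x L w d) (hx : 0 < x) {i u : M} (hi : i ≤ L) (hu : IsBeta w d i u) :
    0 < u :=
  h.induct h (S := fun u _ => 0 < u) (fun _ i _ => .lt (.const 0) (.var i)) one_pos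
    (fun _ _ h => mul_pos hx h) hi hu hu

end IsPowSeq

/-- The integer part of the binary logarithm is unique. -/
theorem isLog_two_unique {y l l' : M} (h : IsLog (1 + 1) y l) (h' : IsLog (1 + 1) y l') :
    l = l' := by
  have key : ∀ l l' : M, IsLog (1 + 1) y l → IsLog (1 + 1) y l' → l' ≤ l := by
    rintro l l' ⟨q, hq, hqy, hyq⟩ ⟨q', hq', hqy', hyq'⟩
    by_contra! hl
    rw [lt_iff] at hyq
    obtain ⟨w, d, h, hq⟩ := isPow_iff.1 hq
    obtain ⟨w', d', h', hq'⟩ := isPow_iff.1 hq'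
    obtain ⟨u, hu⟩ := h'.exists_isBeta hl.le
    have hqu : q ≤ u := h.le_of_le (h'.mono hl.le) le_rfl le_rfl hq hu
    have hmono : ∀ j : M, l + 1 ≤ j → j ≤ l' → ∀ v ≤ w', IsBeta w' d' j v → (1 + 1) * u ≤ v := by
      refine Delta0Induction.induct BoundedArith.induction ?_ ?_ ?_
      · apply_rules (maxDepth := 200) [Delta0Def.isBeta, Delta0Def.ball, Delta0Def.le,
          Delta0Def.imp, TermDef.var, TermDef.add, TermDef.mul, TermDef.const]
      · intro h0
        exact absurd h0 (add_one_le_iff.not.2 not_lt_zero)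
      · intro j ih hj hjl v _ hv
        have hjl := add_one_le_iff.1 hjl
        rcases (lt_add_one_iff.1 (add_one_le_iff.1 hj)).eq_or_lt with rfl | hlt
        · exact (hv.unique (h'.succ hl hu)).ge
        · obtain ⟨v', hv', rfl⟩ := h'.exists_isBeta_pred hjl hv
          refine (ih (add_one_le_iff.2 hlt) hjl.le v' hv'.le hv').trans ?_
          rw [add_mul, one_mul]
          exact le_add_of_nonneg_left zero_le
    have h1 := hmono l' (add_one_le_iff.2 hl) le_rfl q' hq'.le hq'
    refine (hyq.trans_le ?_).not_ge hqy'
    exact (mul_le_mul_right hqu _).trans h1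
  exact le_antisymm (key l' l h' h) (key l l' h h')

/-- By `Ω₁` all sequences of powers whose length is the binary logarithm of `y` have codes. -/
theorem Omega1.exists_powSeq (hΩ : Omega1 M) {y : M} (hy : 0 < y) :
    ∃ l, (∃ q, IsPow (1 + 1) l q ∧ y < (1 + 1) * q) ∧ ∀ x, ∃ w d, IsPowSeq x l w d := by
  obtain ⟨l, -, hl, -⟩ := hΩ 0 y (lt_iff.2 hy)
  refine ⟨l, ?_, fun x => ?_⟩
  · obtain ⟨q, hq, -, hyq⟩ := hl
    exact ⟨q, hq, lt_iff.1 hyq⟩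
  · obtain ⟨l', z, hl', hz⟩ := hΩ x y (lt_iff.2 hy)
    rw [isLog_two_unique hl hl']
    obtain ⟨w, d, h, -⟩ := isPow_iff.1 hz
    exact ⟨w, d, h⟩

/-- The integer part of the logarithm of `a ≤ y` to base `4`, computed in a coded sequence whose
length is the binary logarithm of `y`. -/
theorem exists_isLog_four {a y l w d : M} (ha : 0 < a) (hay : a ≤ y)
    (hl : ∃ q, IsPow (1 + 1) l q ∧ y < (1 + 1) * q) (h : IsPowSeq (1 + 1 + 1 + 1) l w d) :
    ∃ k u, k ≤ l ∧ IsBeta w d k u ∧ u ≤ a ∧ a < (1 + 1 + 1 + 1) * u := by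
  have h24 : (1 + 1 : M) ≤ 1 + 1 + 1 + 1 := by
    rw [add_assoc (1 + 1 : M)]
    exact le_add_of_nonneg_right zero_le
  obtain ⟨q, hq, hyq⟩ := hl
  obtain ⟨w', d', h', hq⟩ := isPow_iff.1 hq
  obtain ⟨u, hu⟩ := h.exists_isBeta le_rfl
  obtain ⟨k, ⟨hk, u, -, hu, hau⟩, hmin⟩ :=
    exists_least (S := fun k => k ≤ l ∧ ∃ u ≤ w, IsBeta w d k u ∧ a < (1 + 1 + 1 + 1) * u)
    (by apply_rules (maxDepth := 200) [Delta0Def.isBeta, Delta0Def.bex, Delta0Def.and, Delta0Def.le,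
          Delta0Def.lt, TermDef.var, TermDef.add, TermDef.mul, TermDef.const])
    ⟨le_rfl, u, hu.le, hu, (hay.trans_lt hyq).trans_le
      (mul_le_mul' h24 (h'.le_of_le h h24 le_rfl hq hu))⟩
  refine ⟨k, u, hk, hu, ?_, hau⟩
  obtain rfl | ⟨j, rfl⟩ := eq_zero_or_eq_add_one k
  · rw [hu.unique h.1]
    exact BoundedArith.one_le_of_pos a ha
  · by_contra! hua
    obtain ⟨v, hv, rfl⟩ := h.exists_isBeta_pred (add_one_le_iff.1 hk) hu
    have := hmin j ⟨(le_add_of_nonneg_right zero_le).trans hk, v, hv.le, hv, hua⟩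
    exact (lt_add_one j).not_ge this

end Powers

/-! ### Legendre's descent -/

section Descent

theorem IsSolution.symm {M : Type*} [CommSemiring M] {a b x y z : M}
    (h : IsSolution a b x y z) : IsSolution b a y x z :=
  ⟨fun h0 => h.1 ⟨h0.2.1, h0.1, h0.2.2⟩, by rw [add_comm, h.2]⟩

variable {M : Type*} [CommSemiring M] [LinearOrder M]

/-- The equation with coefficients `a, b` has a non-trivial solution whose entries are at most
`T / s`.  The quantifiers are bounded by `T`, which for `s ≠ 0` is no restriction. -/
def HasSolution (a b s T : M) : Prop :=
  ∃ x ≤ T, ∃ y ≤ T, ∃ z ≤ T, IsSolution a b x y z ∧ x * s ≤ T ∧ y * s ≤ T ∧ z * s ≤ T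

theorem HasSolution.symm {a b s T : M} (h : HasSolution a b s T) : HasSolution b a s T := by
  obtain ⟨x, hx, y, hy, z, hz, h, hx', hy', hz'⟩ := h
  exact ⟨y, hy, x, hx, z, hz, h.symm, hy', hx', hz'⟩

theorem HasSolution.mono {a b s T T' : M} (h : HasSolution a b s T) (hT : T ≤ T') :
    HasSolution a b s T' := by
  obtain ⟨x, hx, y, hy, z, hz, h, hx', hy', hz'⟩ := h
  exact ⟨x, hx.trans hT, y, hy.trans hT, z, hz.trans hT, h, hx'.trans hT, hy'.trans hT,
    hz'.trans hT⟩

theorem Delta0Def.hasSolution {n : ℕ} {f g h k : (Fin n → M) → M} (hf : TermDef f)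
    (hg : TermDef g) (hh : TermDef h) (hk : TermDef k) :
    Delta0Def fun v => HasSolution (f v) (g v) (h v) (k v) := by
  have hf := hf.lift.lift.lift
  have hg := hg.lift.lift.lift
  have hh := hh.lift.lift.lift
  have hk' := hk.lift.lift.lift
  have hk'' := hk.lift.lift
  have hk''' := hk.lift
  unfold HasSolution IsSolution
  apply_rules (maxDepth := 200) [Delta0Def.bex, Delta0Def.and, Delta0Def.not, Delta0Def.eq,
    Delta0Def.le, TermDef.add, TermDef.mul, TermDef.var, TermDef.const]

variable [BoundedArith M]

open Integers

theorem HasSolution.of_isSolution {a b s T x y z : M} (hs : 0 < s) (h : IsSolution a b x y z)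
    (hx : x * s ≤ T) (hy : y * s ≤ T) (hz : z * s ≤ T) : HasSolution a b s T :=
  ⟨x, (le_mul_of_pos hs).trans hx, y, (le_mul_of_pos hs).trans hy, z, (le_mul_of_pos hs).trans hz,
    h, hx, hy, hz⟩

/-- The base cases of the descent: `a = 1`, `b = 1`, and `a = b`, where `-1` is a square modulo `a`
and hence `a` is a sum of two squares. -/
theorem exists_isSolution_base {a b : M} (ha : 0 < a) (hb : 0 < b) (h : NormConditions a b)
    (hab : a = 1 ∨ b = 1 ∨ a = b) :
    ∃ x y z, IsSolution a b x y z ∧ x ≤ b ∧ y ≤ b ∧ z ≤ b := by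
  rcases hab with rfl | rfl | rfl
  · have := BoundedArith.one_le_of_pos b hb
    exact ⟨1, 0, 1, ⟨by simp, by simp⟩, this, zero_le, this⟩
  · exact ⟨0, 1, 1, ⟨by simp, by simp⟩, zero_le, le_rfl, le_rfl⟩
  · have hr : ∃ r m : M, a * m = r * r + 1 := by
      obtain ⟨-, -, d, a', b', had, hbd, hab, t, ht⟩ := (normConditions_iff ha).1 h
      have hd0 : 0 < d := pos_iff_ne_zero.2 fun h0 => ha.ne' (by rw [had, h0, zero_mul])
      obtain rfl : a' = b' := mul_left_cancel₀ hd0.ne' (had.symm.trans hbd)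
      obtain rfl : a' = 1 := isCoprime_ofNonneg_iff.1 hab a' dvd_rfl dvd_rfl
      obtain rfl : a = d := by rw [had, mul_one]
      obtain ⟨r, hr⟩ : NegSquareMod 1 a := negSquareMod_iff.2 ⟨t, by simpa using ht⟩
      rw [cong_iff, map_zero, sub_zero, ofNonneg_dvd] at hr
      obtain ⟨m, hm⟩ := hr
      exact ⟨r, m, hm.symm⟩
    obtain ⟨r, m, hm⟩ := hr
    obtain ⟨x, y, -, -, hxy, -⟩ := exists_sum_two_squares hm
    refine ⟨x, y, a, ⟨fun h => ha.ne' h.2.2, ?_⟩, ?_, ?_, le_rfl⟩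
    · rw [← mul_add, ← hxy]
    · rcases eq_zero_or_pos x with rfl | hx
      · exact zero_le
      · exact (le_mul_of_pos hx).trans (hxy ▸ le_add_of_nonneg_right zero_le)
    · rcases eq_zero_or_pos y with rfl | hy
      · exact zero_le
      · exact (le_mul_of_pos hy).trans (hxy ▸ le_add_of_nonneg_left zero_le)

/-- A square root `c ≤ a / 2` of `b` modulo `a`, and the square-free part `A` of
`(c ^ 2 - b) / a`. -/
theorem exists_descent {a b : M} (hb : 1 < b) (hba : b < a) (hsb : SquareFree b)
    (h : SquareMod b a) : ∃ c A m : M, c * c = b + a * A * (m * m) ∧ (1 + 1) * c ≤ a ∧ 0 < A ∧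
      0 < m ∧ SquareFree A := by
  have ha : 0 < a := zero_lt_one.trans (hb.trans hba)
  obtain ⟨c, hca, hc⟩ : ∃ c : M, (1 + 1) * c ≤ a ∧
      ofNonneg M a ∣ ofNonneg M c ^ 2 - ofNonneg M b := by
    obtain ⟨x, hx⟩ := h
    rw [cong_iff] at hx
    obtain ⟨q, r, rfl, hr⟩ := exists_div_mod x ha
    have hra : ofNonneg M a ∣ ofNonneg M r ^ 2 - ofNonneg M b := by
      have := hx.sub (dvd_mul_right (ofNonneg M a) (ofNonneg M a * ofNonneg M q ^ 2 +
        2 * ofNonneg M q * ofNonneg M r))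
      refine this.trans (dvd_of_eq ?_)
      simp only [map_mul, map_add]
      ring
    rcases le_total ((1 + 1) * r) a with h2 | h2
    · exact ⟨r, h2, hra⟩
    · obtain ⟨s, rfl⟩ := exists_add_of_le hr.le
      refine ⟨s, ?_, ?_⟩
      · rw [add_mul, one_mul] at h2 ⊢
        gcongr
        exact le_of_add_le_add_left h2
      · have := hra.sub (dvd_mul_right (ofNonneg M (r + s)) (ofNonneg M r - ofNonneg M s))
        refine this.trans (dvd_of_eq ?_)
        simp only [map_add]
        ring
  obtain ⟨k, hk⟩ := hc
  obtain ⟨T, rfl | rfl⟩ := exists_eq_or_eq_neg k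
  · have hcT : c * c = b + a * T := ofNonneg_injective (by
      simp only [map_add, map_mul]; linear_combination hk)
    rcases eq_zero_or_pos T with rfl | hT
    · -- here `b` would be the square of `c`
      have hc1 : c = 1 := hsb c ⟨1, by rw [hcT]; ring⟩
      rw [hc1] at hcT
      exact absurd (by rw [mul_zero, add_zero, mul_one] at hcT; exact hcT) hb.ne
    · obtain ⟨A, m, rfl, hA⟩ := exists_squareFree_mul_sq hT
      have hm : 0 < m * m := pos_of_mul_pos_right hT zero_le
      exact ⟨c, A, m, by rw [hcT, mul_assoc], hca, pos_of_mul_pos_left hT zero_le,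
        pos_of_mul_pos_left hm zero_le, hA⟩
  · -- a negative quotient would give `c ^ 2 + a * T = b < a`
    have hcT : c * c + a * T = b := ofNonneg_injective (by
      simp only [map_add, map_mul]; linear_combination hk)
    rcases eq_zero_or_pos T with rfl | hT
    · have hc1 : c = 1 := hsb c ⟨1, by rw [← hcT]; ring⟩
      rw [hc1] at hcT
      exact absurd (by rw [mul_zero, add_zero, mul_one] at hcT; exact hcT) hb.ne
    · exact absurd hcT (((hba.trans_le (le_mul_of_pos hT)).trans_le
        (le_add_of_nonneg_left zero_le)).ne')

/-- From a solution for `A, b` one for `a, b` is obtained by multiplying `Z + Y √b` by `c + √b`,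
where `c ^ 2 - b = a * A * m ^ 2`. -/
theorem IsSolution.ascent {a b A c m X Y Z : M} (hA : 0 < A) (hb : 0 < b) (hm : 0 < m)
    (hc : c * c = b + a * A * (m * m)) (h : IsSolution A b X Y Z) :
    IsSolution a b (A * m * X) (c * Y + Z) (b * Y + c * Z) := by
  obtain ⟨h0, h⟩ := h
  refine ⟨fun ⟨hx, hy, hz⟩ => h0 ⟨?_, ?_, (add_eq_zero.1 hy).2⟩, ?_⟩
  · exact (mul_eq_zero.1 hx).resolve_left (mul_pos hA hm).ne'
  · exact (mul_eq_zero.1 (add_eq_zero.1 hz).1).resolve_left hb.ne'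
  · have h := congrArg (ofNonneg M) h
    have hc := congrArg (ofNonneg M) hc
    refine ofNonneg_injective ?_
    simp only [map_add, map_mul] at h hc ⊢
    linear_combination (ofNonneg M c * ofNonneg M c - ofNonneg M b) * h -
      ofNonneg M A * ofNonneg M X * ofNonneg M X * hc

/-- The new coefficient, even together with its square cofactor, is less than `a / 4`, because
`a * A * m ^ 2 < c ^ 2 ≤ a ^ 2 / 4`. -/
theorem four_mul_lt_of_descent {a b A c m : M} (hb : 0 < b) (hc : c * c = b + a * A * (m * m))
    (hca : (1 + 1) * c ≤ a) : (1 + 1 + 1 + 1) * (A * (m * m)) < a := by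
  refine lt_of_mul_lt_mul_left (a := a) ?_ zero_le
  calc a * ((1 + 1 + 1 + 1) * (A * (m * m)))
      < (1 + 1 + 1 + 1) * b + a * ((1 + 1 + 1 + 1) * (A * (m * m))) :=
        lt_add_of_pos_left _ (by positivity)
    _ = (1 + 1 + 1 + 1) * (c * c) := by rw [hc]; ring
    _ = ((1 + 1) * c) * ((1 + 1) * c) := by ring
    _ ≤ a * a := mul_le_mul' hca hca

/-- One step of the descent enlarges the bound on the solution by the factor `3 a / 2`. -/
theorem HasSolution.ascent {a b A c m s T : M} (hA : 0 < A) (hb : 0 < b) (hm : 0 < m)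
    (hs : 0 < s) (hba : b < a) (hc : c * c = b + a * A * (m * m)) (hca : (1 + 1) * c ≤ a)
    (h : HasSolution A b s T) : HasSolution a b ((1 + 1) * s) ((1 + 1 + 1) * a * T) := by
  obtain ⟨X, -, Y, -, Z, -, h, hX, hY, hZ⟩ := h
  have ha : 0 < a := hb.trans hba
  have hAm : A * m ≤ a := by
    refine le_trans ?_ (four_mul_lt_of_descent hb hc hca).le
    calc A * m ≤ A * m * (m * (1 + 1 + 1 + 1)) := le_mul_of_pos (by positivity)
      _ = _ := by ring
  have h1 := BoundedArith.one_le_of_pos a ha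
  refine .of_isSolution (mul_pos (by positivity) hs) (h.ascent hA hb hm hc) ?_ ?_ ?_
  · calc A * m * X * ((1 + 1) * s) = ((1 + 1) * (A * m)) * (X * s) := by ring
      _ ≤ ((1 + 1) * a) * T := by gcongr
      _ ≤ (1 + 1 + 1) * a * T := by gcongr; exact le_add_of_nonneg_right zero_le
  · calc (c * Y + Z) * ((1 + 1) * s) = ((1 + 1) * c) * (Y * s) + (1 + 1) * (Z * s) := by ring
      _ ≤ a * T + (1 + 1) * (a * T) := by
          refine add_le_add (mul_le_mul' hca hY) (mul_le_mul_right ?_ _)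
          exact hZ.trans (le_mul_of_one_le_left zero_le h1)
      _ = _ := by ring
  · calc (b * Y + c * Z) * ((1 + 1) * s) = (1 + 1) * b * (Y * s) + ((1 + 1) * c) * (Z * s) := by
          ring
      _ ≤ (1 + 1) * a * T + a * T := by gcongr
      _ = _ := by ring

/-- The descent.  Along it `a₀, b₀` stay fixed as bases of the powers in the bound, so that one
coded sequence for each of the bases `2`, `3 a₀`, `3 b₀` serves for all steps and the statement is
bounded. -/
theorem hasSolution_of_normConditions {a₀ b₀ l w d w₁ d₁ w₂ d₂ : M} (ha₀ : 0 < a₀) (hb₀ : 0 < b₀)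
    (h : IsPowSeq (1 + 1) l w d) (h₁ : IsPowSeq ((1 + 1 + 1) * a₀) l w₁ d₁)
    (h₂ : IsPowSeq ((1 + 1 + 1) * b₀) l w₂ d₂) :
    ∀ n : M, ∀ a ≤ a₀, ∀ b ≤ b₀, a + b = n → SquareFree a → SquareFree b → (0 < a ∧ NormConditions a b) →
      0 < b → ∀ i ≤ l, ∀ j ≤ l, ∀ p ≤ w, ∀ q ≤ w, ∀ P ≤ w₁, ∀ Q ≤ w₂,
      IsBeta w d i p → IsBeta w d j q → IsBeta w₁ d₁ i P → IsBeta w₂ d₂ j Q →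
      a < (1 + 1 + 1 + 1) * (p * p) → b < (1 + 1 + 1 + 1) * (q * q) →
      HasSolution a b (p * q) (b₀ * (P * Q)) := by
  have two_pos : (0 : M) < 1 + 1 := by positivity
  have two_le : ∀ {x : M}, 0 < x → 1 + 1 ≤ (1 + 1 + 1) * x := fun hx =>
    (le_add_of_nonneg_right zero_le).trans (le_mul_of_pos hx)
  refine strong_induct ?_ fun n ih => ?_
  · apply_rules (maxDepth := 400) [Delta0Def.normConditions, Delta0Def.squareFree,
      Delta0Def.hasSolution, Delta0Def.isBeta, Delta0Def.ball, Delta0Def.lt, Delta0Def.eq,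
      Delta0Def.imp, TermDef.var, TermDef.add, TermDef.mul, TermDef.const]
  rintro a haa b hbb rfl hsa hsb ⟨ha, hab⟩ hb i hi j hj p _ q _ P _ Q _ hp hq hP hQ hap hbq
  have hp0 : 0 < p := h.pos two_pos hi hp
  have hq0 : 0 < q := h.pos two_pos hj hq
  by_cases hbase : a = 1 ∨ b = 1 ∨ a = b
  · obtain ⟨x, y, z, hxyz, hx, hy, hz⟩ := exists_isSolution_base ha hb hab hbase
    have hpq : p * q ≤ P * Q :=
      mul_le_mul' (h.le_of_le h₁ (two_le ha₀) hi hp hP) (h.le_of_le h₂ (two_le hb₀) hj hq hQ)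
    exact .of_isSolution (mul_pos hp0 hq0) hxyz (mul_le_mul' (hx.trans hbb) hpq)
      (mul_le_mul' (hy.trans hbb) hpq) (mul_le_mul' (hz.trans hbb) hpq)
  push Not at hbase
  have lt_of_ne_one : ∀ {x : M}, 0 < x → x ≠ 1 → 1 < x := fun hx hx1 =>
    lt_of_le_of_ne (BoundedArith.one_le_of_pos _ hx) hx1.symm
  -- a smaller coefficient is less than a quarter, so the exponent drops by one
  have index : ∀ {a A i p m : M}, 0 < A → 0 < m → a < (1 + 1 + 1 + 1) * (p * p) → IsBeta w d i p →
      i ≤ l → (1 + 1 + 1 + 1) * (A * (m * m)) < a → ∃ k p', i = k + 1 ∧ k < l ∧ p = (1 + 1) * p' ∧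
        IsBeta w d k p' ∧ A < (1 + 1 + 1 + 1) * (p' * p') ∧ A < a := by
    intro a A i p m hA hm hap hp hi h4
    have hAm : A ≤ A * (m * m) := le_mul_of_pos (mul_pos hm hm)
    have hAp : A < p * p := by
      refine lt_of_mul_lt_mul_left (a := (1 + 1 + 1 + 1 : M)) ?_ zero_le
      refine lt_of_le_of_lt ?_ (h4.trans hap)
      gcongr
    have hAa : A < a := by
      refine lt_of_le_of_lt (hAm.trans ?_) h4
      exact (le_mul_of_pos (y := 1 + 1 + 1 + 1) (by positivity)).trans (mul_comm _ _).le
    obtain rfl | ⟨k, rfl⟩ := eq_zero_or_eq_add_one i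
    · rw [hp.unique h.1, mul_one] at hAp
      exact absurd (BoundedArith.one_le_of_pos A hA) hAp.not_ge
    · obtain ⟨p', hp', rfl⟩ := h.exists_isBeta_pred (add_one_le_iff.1 hi) hp
      refine ⟨k, p', rfl, add_one_le_iff.1 hi, rfl, hp', ?_, hAa⟩
      convert hAp using 1
      ring
  rcases lt_or_gt_of_ne hbase.2.2 with hlt | hlt
  · obtain ⟨c, B, m, hc, hcb, hB, hm, hsB⟩ :=
      exists_descent (lt_of_ne_one ha hbase.1) hlt hsa hab.1
    have hBa := hab.symm.descent hb hB ha hsb hsa hc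
    obtain ⟨k, q', rfl, hk, rfl, hq', hBq, hBb⟩ :=
      index hB hm hbq hq hj (four_mul_lt_of_descent ha hc hcb)
    obtain ⟨Q', hQ', rfl⟩ := h₂.exists_isBeta_pred hk hQ
    have key := ih (a + B) (by gcongr) a haa B (hBb.le.trans hbb) rfl hsa hsB ⟨ha, hBa.symm⟩ hB i hi
      k hk.le p hp.le q' hq'.le P hP.le Q' hQ'.le hp hq' hP hQ' hap hBq
    have := (HasSolution.ascent hB ha hm (mul_pos hp0 (h.pos two_pos hk.le hq')) hlt hc hcb
      key.symm).symm
    rw [mul_left_comm p]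
    refine this.mono ?_
    calc (1 + 1 + 1) * b * (b₀ * (P * Q')) ≤ (1 + 1 + 1) * b₀ * (b₀ * (P * Q')) := by gcongr
      _ = _ := by ring
  · obtain ⟨c, A, m, hc, hca, hA, hm, hsA⟩ :=
      exists_descent (lt_of_ne_one hb hbase.2.1) hlt hsb hab.2.1
    have hAb := hab.descent ha hA hb hsa hsb hc
    obtain ⟨k, p', rfl, hk, rfl, hp', hAp, hAa⟩ :=
      index hA hm hap hp hi (four_mul_lt_of_descent hb hc hca)
    obtain ⟨P', hP', rfl⟩ := h₁.exists_isBeta_pred hk hP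
    have key := ih (A + b) (by gcongr) A (hAa.le.trans haa) b hbb rfl hsA hsb ⟨hA, hAb⟩ hb k hk.le
      j hj p' hp'.le q hq.le P' hP'.le Q hQ.le hp' hq hP' hQ hAp hbq
    have := HasSolution.ascent hA hb hm (mul_pos (h.pos two_pos hk.le hp') hq0) hlt hc hca key
    rw [mul_assoc]
    refine this.mono ?_
    calc (1 + 1 + 1) * a * (b₀ * (P' * Q)) ≤ (1 + 1 + 1) * a₀ * (b₀ * (P' * Q)) := by gcongr
      _ = _ := by ring

/-- The descent starts with the exponents `⌊log₄ a⌋` and `⌊log₄ b⌋`, read off from a coded sequence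
of powers of `4`.  All sequences have the length `⌊log₂ (a + b)⌋`, which is at least both exponents. -/
theorem exists_isSolution_legendreBound (hΩ : Omega1 M) {a b : M} (ha : 0 < a) (hb : 0 < b)
    (hsa : SquareFree a) (hsb : SquareFree b) (hab : NormConditions a b) :
    ∃ x y z : M, IsSolution a b x y z ∧ LegendreBound a b x y z := by
  obtain ⟨l, hl, hpow⟩ := hΩ.exists_powSeq (y := a + b) (by positivity)
  obtain ⟨w, d, h⟩ := hpow (1 + 1)
  obtain ⟨w₄, d₄, h₄⟩ := hpow (1 + 1 + 1 + 1)
  obtain ⟨w₁, d₁, h₁⟩ := hpow ((1 + 1 + 1) * a)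
  obtain ⟨w₂, d₂, h₂⟩ := hpow ((1 + 1 + 1) * b)
  have sq : ∀ {i p r : M}, i ≤ l → IsBeta w d i p → IsBeta w₄ d₄ i r → r = p * p := fun hi hp hr =>
    h.induct h₄ (S := fun p r => r = p * p) (fun _ i j => .eq (.var j) (.mul (.var i) (.var i)))
      (mul_one 1).symm (fun p r hpr => by rw [hpr]; ring) hi hp hr
  obtain ⟨i, r, hi, hr, hra, har⟩ :=
    exists_isLog_four ha (le_add_of_nonneg_right (zero_le (a := b))) hl h₄
  obtain ⟨j, s, hj, hs, hsb', hbs⟩ :=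
    exists_isLog_four hb (le_add_of_nonneg_left (zero_le (a := a))) hl h₄
  obtain ⟨p, hp⟩ := h.exists_isBeta hi
  obtain ⟨q, hq⟩ := h.exists_isBeta hj
  obtain ⟨P, hP⟩ := h₁.exists_isBeta hi
  obtain ⟨Q, hQ⟩ := h₂.exists_isBeta hj
  obtain ⟨x, -, y, -, z, -, hxyz, hx, hy, hz⟩ := hasSolution_of_normConditions ha hb h h₁ h₂ _
    a le_rfl b le_rfl rfl hsa hsb ⟨ha, hab⟩ hb i hi j hj p hp.le q hq.le P hP.le Q hQ.le hp hq hP hQ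
    (sq hi hp hr ▸ har) (sq hj hq hs ▸ hbs)
  exact ⟨x, y, z, hxyz, i, j, P, p, Q, q, ⟨r, h₄.isPow hi hr, hra, lt_iff.2 har⟩,
    ⟨s, h₄.isPow hj hs, hsb', lt_iff.2 hbs⟩, h₁.isPow hi hP, h.isPow hi hp, h₂.isPow hj hQ,
    h.isPow hj hq, hx, hy, hz⟩

end Descent

end WeakArith

theorem theorem2p11 {M : Type*} [Zero M] [One M] [Add M] [Mul M] [LE M]
    (hM : WeakArith.ModelIDelta0Omega1 M) (a b : M)
    (ha : WeakArith.Lt 0 a) (hb : WeakArith.Lt 0 b)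
    (hsa : WeakArith.SquareFree a) (hsb : WeakArith.SquareFree b) :
    ((∃ x y z : M, WeakArith.IsSolution a b x y z) ↔ WeakArith.NormConditions a b) ∧
    (WeakArith.NormConditions a b →
      ∃ x y z : M, WeakArith.IsSolution a b x y z ∧ WeakArith.LegendreBound a b x y z) := by
  let := hM.paMinus.commSemiring
  let := hM.paMinus.linearOrder
  have := hM.paMinus.boundedArith hM.induction
  have key := WeakArith.exists_isSolution_legendreBound hM.omega1 (WeakArith.lt_iff.1 ha)
    (WeakArith.lt_iff.1 hb) hsa hsb
  refine ⟨⟨fun ⟨x, y, z, h⟩ => ?_, fun h => ?_⟩, key⟩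
  · exact WeakArith.normConditions_of_isSolution (WeakArith.lt_iff.1 ha) (WeakArith.lt_iff.1 hb)
      hsa hsb h
  · obtain ⟨x, y, z, h, -⟩ := key h
    exact ⟨x, y, z, h⟩
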